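/- For $0<c<1$ let $\int_{0\swarrow1}$ denote integration along the whole straight line of slope $1$ through $c$, traversed from the upper right to the lower left, i.e. $x=c-e^{\pi i/4}y$ with $y$ running from $-\infty$ to $\infty$. Let $\int_{0\searrow1}$ denote integration along the whole straight line of slope $-1$ through a point $d\in(0,1)$, traversed from the upper left to the lower right, i.e. $x=d+e^{-\pi i/4}y$ with $y$ running from $-\infty$ to $\infty$. Powers of $x$ take their principal values in the plane cut along $(-\infty,0]$. Put $$\mathfrak f(s)=\int_{0\swarrow1}\frac{x^{-s}e^{\pi i x^2}}{e^{\pi i x}-e^{-\pi i x}}\,dx,\qquad \mathfrak g(s)=\int_{0\searrow1}\frac{x^{s-1}e^{-\pi i x^2}}{e^{\pi i x}-e^{-\pi i x}}\,dx,\qquad \varphi(s)=2\pi^{-s/2}\Gamma\!\left(\tfrac s2\right)\mathfrak f(s).$$ Then, for any choice of the crossing points $c,d\in(0,1)$: (a) Both integrals converge absolutely for every $s\in\mathbb C$, and $\mathfrak f$ and $\mathfrak g$ are entire functions. (b) For all $s\in\mathbb C$ other than the poles $s=0,-2,-4,\dots$ of $\Gamma(s/2)$ and the poles $s=1,3,5,\dots$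 of $\Gamma((1-s)/2)$ (hence, as an identity of meromorphic functions, in the whole $s$-plane), $$\pi^{-\frac{1-s}2}\Gamma\!\left(\tfrac{1-s}2\right)\zeta(1-s)=\pi^{-\frac s2}\Gamma\!\left(\tfrac s2\right)\int_{0\swarrow1}\frac{x^{-s}e^{\pi i x^2}}{e^{\pi i x}-e^{-\pi i x}}\,dx+\pi^{-\frac{1-s}2}\Gamma\!\left(\tfrac{1-s}2\right)\int_{0\searrow1}\frac{x^{s-1}e^{-\pi i x^2}}{e^{\pi i x}-e^{-\pi i x}}\,dx .$$ (c) For the same $s$, $$\pi^{-\frac s2}\Gamma\!\left(\tfrac s2\right)\zeta(s)=\pi^{-\frac{1-s}2}\Gamma\!\left(\tfrac{1-s}2\right)\zeta(1-s).$$ (d) For all $s$ with $\operatorname{Re}s=\tfrac12$, $$\pi^{-\frac s2}\Gamma\!\left(\tfrac s2\right)\zeta(s)=\operatorname{Re}\varphi(s).$$ -/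

import Mathlib

noncomputable section

namespace RiemannIntegral

/-- The integral of `F` along the whole straight line through `p`, traversed in the
direction of `v`. -/
def lineIntegral (F : ℂ → ℂ) (p v : ℂ) : ℂ :=
  ∫ y : ℝ, F (p + y * v) * v

/-- Absolute convergence of `lineIntegral F p v`. -/
def LineIntegrable (F : ℂ → ℂ) (p v : ℂ) : Prop :=
  MeasureTheory.Integrable (fun y : ℝ => F (p + y * v) * v)

/-- The direction `↙`: from the upper right to the lower left, at slope `1`. -/
def dirSW : ℂ := -Complex.exp (Real.pi * Complex.I / 4)

/-- The direction `↘`: from the upper left to the lower right, at slope `-1`. -/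
def dirSE : ℂ := Complex.exp (-(Real.pi * Complex.I / 4))

/-- The integrand `x ^ (-s) e^{π i x²} / (e^{π i x} - e^{-π i x})`, principal branch of the power. -/
def integrandSW (s x : ℂ) : ℂ :=
  x ^ (-s) * Complex.exp (Real.pi * Complex.I * x ^ 2) /
    (Complex.exp (Real.pi * Complex.I * x) - Complex.exp (-(Real.pi * Complex.I * x)))

/-- The integrand `x ^ (s - 1) e^{-π i x²} / (e^{π i x} - e^{-π i x})`, principal branch of the
power. -/
def integrandSE (s x : ℂ) : ℂ :=
  x ^ (s - 1) * Complex.exp (-(Real.pi * Complex.I * x ^ 2)) /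
    (Complex.exp (Real.pi * Complex.I * x) - Complex.exp (-(Real.pi * Complex.I * x)))

/-- The function `𝔣(s)`: the integral of `integrandSW s` along the line of direction `↙` that
crosses the real axis at `c`. -/
def frakF (c : ℝ) (s : ℂ) : ℂ := lineIntegral (integrandSW s) c dirSW

/-- The integral of `integrandSE s` along the line of direction `↘` that crosses the real axis
at `c`. -/
def frakG (c : ℝ) (s : ℂ) : ℂ := lineIntegral (integrandSE s) c dirSE

/-- The function `φ(s) = 2 π^{-s/2} Γ(s/2) 𝔣(s)`. -/
def phi (c : ℝ) (s : ℂ) : ℂ :=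
  2 * (Real.pi : ℂ) ^ (-s / 2) * Complex.Gamma (s / 2) * frakF c s

end RiemannIntegral

end

noncomputable section

open Complex Filter Topology MeasureTheory Set

namespace RiemannIntegral

/-! The core is Mordell's integral Φ(u), taken along `↘` with integrand e^{-πix²+2πiux}/(e^{πix} -
e^{-πix}). Passing from u to u-1 cancels the denominator and leaves a Gaussian (`mordell_sub`).
Moving the line by 1 crosses only the pole x = 1, and by quasi-periodicity the shifted integral is a
multiple of Φ(u-1) (`mordell_sub_mordell_add_one`). Solving these two linear equations gives Φ(u) =
q/(1-q) + e^{πiu²}/(e^{πiu} - e^{-πiu}) with q = e^{2πiu} (`mordell_mul_dirSE`).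

For Re s < -1, multiply by u^{-s} and integrate along the ray arg u = π/4. The left side becomes a
multiple of Γ(1-s)𝔤(s), the geometric term gives Γ(1-s)ζ(1-s), and the last term is `rayIntegral`
(`Gamma_mul_frakG_eq`). Pushing the line of 𝔣 into the origin turns 𝔣 into two phases times the same
ray integral (`frakF_eq_rayIntegral`). Eliminating it and using the reflection formula for `Gammaℝ`
gives the representation; the identity theorem extends it (`Gammaℝ_inv_mul_eq`).

Conjugation gives 𝔤(s) = conj 𝔣(1 - conj s) (`frakG_eq_conj`). Thus 𝔤 inherits the analytic
properties of 𝔣, and on Re s = 1/2 the two terms are conjugate, whence the real part. Lines of slope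
±1 are handled throughout as horizontal lines in a rotated coordinate w. -/

/-! ### Shifting horizontal lines of integration -/

/-- The closed horizontal strip `a ≤ Im z ≤ b`. -/
def strip (a b : ℝ) : Set ℂ := {z | z.im ∈ Icc a b}

/-- `G` is small at both ends of the strip `a ≤ Im z ≤ b`, uniformly in the imaginary part. -/
def StripDecay (G : ℂ → ℂ) (a b : ℝ) : Prop :=
  ∃ B : ℝ → ℝ, Tendsto B atTop (𝓝 0) ∧
    ∀ᶠ T : ℝ in atTop, ∀ x : ℝ, |x| = T → ∀ t ∈ Icc a b, ‖G (x + t * I)‖ ≤ B T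

/-- The vertical sides of the Cauchy rectangle vanish in the limit; `u` will be both `T` and `-T`.
-/
lemma StripDecay.tendsto_vertical {G : ℂ → ℂ} {a b : ℝ} (hab : a ≤ b) (h : StripDecay G a b)
    {u : ℝ → ℝ} (hu : ∀ᶠ T in atTop, |u T| = T) :
    Tendsto (fun T : ℝ => ∫ t : ℝ in a..b, G (u T + t * I)) atTop (𝓝 0) := by
  obtain ⟨B, hB, hG⟩ := h
  rw [tendsto_zero_iff_norm_tendsto_zero]
  have h0 : Tendsto (fun T => B T * |b - a|) atTop (𝓝 0) := by simpa using hB.mul_const |b - a|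
  refine tendsto_of_tendsto_of_tendsto_of_le_of_le' tendsto_const_nhds h0
    (Eventually.of_forall fun _ => norm_nonneg _) ?_
  filter_upwards [hG, hu] with T hT huT
  refine intervalIntegral.norm_integral_le_of_norm_le_const fun t ht => ?_
  rw [uIoc_of_le hab] at ht
  exact hT _ huT t ⟨ht.1.le, ht.2⟩

/-- Cauchy's theorem for a horizontal strip. -/
theorem integral_horizontal_eq {G : ℂ → ℂ} {a b : ℝ} (hab : a ≤ b)
    (hd : DifferentiableOn ℂ G (strip a b)) (hdec : StripDecay G a b)
    (ha : Integrable fun x : ℝ => G (x + a * I)) (hb : Integrable fun x : ℝ => G (x + b * I)) :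
    ∫ x : ℝ, G (x + a * I) = ∫ x : ℝ, G (x + b * I) := by
  have hA := intervalIntegral_tendsto_integral ha tendsto_neg_atTop_atBot tendsto_id
  have hB := intervalIntegral_tendsto_integral hb tendsto_neg_atTop_atBot tendsto_id
  have hR : Tendsto (fun T : ℝ => ∫ t : ℝ in a..b, G (T + t * I)) atTop (𝓝 0) :=
    hdec.tendsto_vertical hab (u := fun T => T)
      ((eventually_ge_atTop 0).mono fun T hT => abs_of_nonneg hT)
  have hL : Tendsto (fun T : ℝ => ∫ t : ℝ in a..b, G ((-T : ℝ) + t * I)) atTop (𝓝 0) :=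
    hdec.tendsto_vertical hab (u := fun T => -T)
      ((eventually_ge_atTop 0).mono fun T hT => by rw [abs_neg, abs_of_nonneg hT])
  have hC : ∀ T : ℝ, (∫ x : ℝ in -T..T, G (x + a * I)) - (∫ x : ℝ in -T..T, G (x + b * I))
      + I * (∫ t : ℝ in a..b, G (T + t * I)) - I * (∫ t : ℝ in a..b, G ((-T : ℝ) + t * I)) = 0 := by
    intro T
    have := integral_boundary_rect_eq_zero_of_differentiableOn G (-T + a * I) (T + b * I)
      (hd.mono fun z hz => by
        have := hz.2
        simpa [strip, uIcc_of_le hab] using this)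
    simpa using this
  have hlim := (((hA.sub hB).add (hR.const_mul I)).sub (hL.const_mul I))
  simp only [id, hC, mul_zero, add_zero, sub_zero] at hlim
  exact sub_eq_zero.mp (tendsto_nhds_unique hlim tendsto_const_nhds)

/-! ### Crossing a simple pole -/

/-- A rational comparison kernel: an odd function with a simple pole of residue `1` at `0`, whose
other poles are `± 2 i`. -/
def poleKernel (z : ℂ) : ℂ := 4 / (z * (z ^ 2 + 4))

lemma sq_add_four_ne_zero {z : ℂ} (hz : |z.im| < 2) : z ^ 2 + 4 ≠ 0 := by
  intro h
  have h1 : (z - 2 * I) * (z + 2 * I) = 0 := by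
    linear_combination h - 4 * I_sq
  rcases mul_eq_zero.mp h1 with h2 | h2
  · have := congrArg Complex.im h2
    simp at this
    rw [abs_lt] at hz; linarith [hz.2]
  · have := congrArg Complex.im h2
    simp at this
    rw [abs_lt] at hz; linarith [hz.1]

lemma poleKernel_neg (z : ℂ) : poleKernel (-z) = -poleKernel z := by
  simp only [poleKernel, neg_mul, div_neg, neg_sq]

/-- Partial fractions: the kernel differs from 1/z by a function holomorphic in |Im z| < 2. Unlike
1/z it decays quadratically, so its line integrals converge absolutely. -/
lemma poleKernel_eq {z : ℂ} (hz : z ≠ 0) (h : |z.im| < 2) :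
    poleKernel z = 1 / z - z / (z ^ 2 + 4) := by
  have := sq_add_four_ne_zero h
  rw [poleKernel]; field_simp; ring

lemma norm_poleKernel_le {x t : ℝ} (hx : 4 ≤ |x|) :
    ‖poleKernel (x + t * I)‖ ≤ 1 / x ^ 2 := by
  have h1 : |x| ≤ ‖(x + t * I : ℂ)‖ := by simpa using abs_re_le_norm (x + t * I : ℂ)
  set z : ℂ := x + t * I
  have hx0 : 0 < |x| := by linarith
  -- Both factors of z² + 4 = (z - 2i)(z + 2i) have real part x, so the product is at least x² ≥
  -- 4|x|.
  have h2 : 4 * |x| ≤ ‖z ^ 2 + 4‖ := by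
    have : ‖z ^ 2‖ - ‖(4 : ℂ)‖ ≤ ‖z ^ 2 + 4‖ := by
      have := norm_sub_norm_le (z ^ 2) (-4)
      rwa [norm_neg, sub_neg_eq_add] at this
    rw [norm_pow] at this
    have h4 : ‖(4 : ℂ)‖ = 4 := by simp
    rw [h4] at this
    have him : z ^ 2 + 4 = (z - 2 * I) * (z + 2 * I) := by linear_combination 4 * I_sq
    have ha : |x| ≤ ‖z - 2 * I‖ := by simpa [z] using abs_re_le_norm (z - 2 * I)
    have hb : |x| ≤ ‖z + 2 * I‖ := by simpa [z] using abs_re_le_norm (z + 2 * I)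
    rw [him, norm_mul]
    nlinarith [mul_le_mul ha hb hx0.le (norm_nonneg _)]
  rw [poleKernel, norm_div, norm_mul]
  have h4 : ‖(4 : ℂ)‖ = 4 := by simp
  rw [h4, div_le_div_iff₀ (by nlinarith [mul_le_mul h1 h2 (by positivity) (norm_nonneg _)])
    (by rw [← sq_abs]; positivity), ← sq_abs x]
  nlinarith [mul_le_mul h1 h2 (by positivity) (norm_nonneg _)]

lemma continuous_poleKernel_line {t : ℝ} (h0 : t ≠ 0) (ht : |t| < 2) :
    Continuous fun x : ℝ => poleKernel (x + t * I) := by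
  unfold poleKernel
  refine Continuous.div (by fun_prop) (by fun_prop) fun x => mul_ne_zero ?_ ?_
  · intro h
    apply h0
    simpa using congrArg Complex.im h
  · exact sq_add_four_ne_zero (by simpa using ht)

lemma integrable_poleKernel_line {t : ℝ} (h0 : t ≠ 0) (ht : |t| < 2) :
    Integrable fun x : ℝ => poleKernel (x + t * I) := by
  refine (continuous_poleKernel_line h0 ht).locallyIntegrable.integrable_of_isBigO_cocompact
    (g := fun x : ℝ => (1 + x ^ 2)⁻¹) ?_ (integrable_inv_one_add_sq.integrableAtFilter _)
  refine Asymptotics.IsBigO.of_bound 2 ?_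
  have : ∀ᶠ x : ℝ in cocompact ℝ, 4 ≤ |x| := by
    simpa using (tendsto_norm_cocompact_atTop (E := ℝ)).eventually_ge_atTop 4
  filter_upwards [this] with x hx
  refine (norm_poleKernel_le hx).trans ?_
  have hx2 : 16 ≤ x ^ 2 := by rw [← sq_abs]; nlinarith
  rw [Real.norm_of_nonneg (by positivity), ← div_eq_mul_inv, div_le_div_iff₀ (by positivity)
    (by positivity)]
  linarith

lemma integral_inv_add_sq {k : ℝ} (hk : 0 < k) : ∫ x : ℝ, (x ^ 2 + k ^ 2)⁻¹ = Real.pi / k := by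
  have h := integral_univ_inv_one_add_sq
  have h2 := Measure.integral_comp_div (fun x : ℝ => (1 + x ^ 2)⁻¹) k
  rw [h, abs_of_pos hk, smul_eq_mul] at h2
  have : ∀ x : ℝ, (x ^ 2 + k ^ 2)⁻¹ = (k ^ 2)⁻¹ * (1 + (x / k) ^ 2)⁻¹ := by
    intro x; rw [← mul_inv]; congr 1; field_simp; ring
  simp_rw [this]
  rw [integral_const_mul, h2]; field_simp

/-- At z = x + i the factors z, z - 2i, z + 2i are x + i, x - i, x + 3i. -/
lemma poleKernel_line_one (x : ℝ) :
    poleKernel (x + (1 : ℝ) * I) = 4 * (x - 3 * I) / ((x ^ 2 + 1) * (x ^ 2 + 9)) := by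
  have h1 : (x : ℂ) + I ≠ 0 := fun h => by simpa using congrArg Complex.im h
  have h3 : ((x : ℂ) + I) ^ 2 + 4 ≠ 0 := sq_add_four_ne_zero (by simp)
  have h5 : (x : ℂ) ^ 2 + 1 ≠ 0 := by
    have : (x ^ 2 + 1 : ℝ) ≠ 0 := by positivity
    exact_mod_cast this
  have h6 : (x : ℂ) ^ 2 + 9 ≠ 0 := by
    have : (x ^ 2 + 9 : ℝ) ≠ 0 := by positivity
    exact_mod_cast this
  simp only [poleKernel, ofReal_one, one_mul]
  rw [div_eq_div_iff (mul_ne_zero h1 h3) (mul_ne_zero h5 h6)]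
  linear_combination (12 * (I ^ 2 + 3) + 32 * x * I + 24 * x ^ 2) * I_sq

/-- Folding x ↦ -x cancels the odd part and leaves two arctangent integrals: twice the value is
-3i(π - π/3) = -2πi. -/
lemma integral_poleKernel_line_one : ∫ x : ℝ, poleKernel (x + (1 : ℝ) * I) = -(Real.pi * I) := by
  have hint := integrable_poleKernel_line (t := 1) one_ne_zero (by norm_num)
  have hrefl := integral_neg_eq_self (fun x : ℝ => poleKernel (x + (1 : ℝ) * I)) volume
  have hsum : ∀ x : ℝ, poleKernel (x + (1 : ℝ) * I) + poleKernel ((-x : ℝ) + (1 : ℝ) * I)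
      = (-3 * I) * (((x ^ 2 + 1 ^ 2)⁻¹ - (x ^ 2 + 3 ^ 2)⁻¹ : ℝ) : ℂ) := by
    intro x
    have h5 : (x : ℂ) ^ 2 + 1 ≠ 0 := by
      have : (x ^ 2 + 1 : ℝ) ≠ 0 := by positivity
      exact_mod_cast this
    have h6 : (x : ℂ) ^ 2 + 9 ≠ 0 := by
      have : (x ^ 2 + 9 : ℝ) ≠ 0 := by positivity
      exact_mod_cast this
    rw [poleKernel_line_one, poleKernel_line_one]
    push_cast
    rw [neg_sq, one_pow, show (3 : ℂ) ^ 2 = 9 by norm_num]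
    field_simp
    ring
  have hi : ∀ k : ℝ, 0 < k → Integrable fun x : ℝ => (x ^ 2 + k ^ 2)⁻¹ := fun k hk => by
    -- A non-integrable function has integral 0 by convention, while this integral is π/k > 0.
    by_contra hc
    have h := integral_inv_add_sq hk
    rw [integral_undef hc] at h
    have : 0 < Real.pi / k := by positivity
    linarith
  have h2 : (∫ x : ℝ, poleKernel (x + (1 : ℝ) * I)) + ∫ x : ℝ, poleKernel (x + (1 : ℝ) * I)
      = (-3 * I) * ((Real.pi / 1 - Real.pi / 3 : ℝ) : ℂ) := by
    conv_lhs => rw [← hrefl]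
    nth_rewrite 1 [hrefl]
    rw [← integral_add hint hint.comp_neg, integral_congr_ae (Eventually.of_forall hsum),
      integral_const_mul, integral_complex_ofReal, integral_sub (hi 1 one_pos) (hi 3 (by norm_num)),
      integral_inv_add_sq one_pos, integral_inv_add_sq (by norm_num)]
  push_cast at h2
  linear_combination h2 / 2

lemma stripDecay_poleKernel (a b : ℝ) : StripDecay poleKernel a b := by
  refine ⟨fun x => 1 / x ^ 2, ?_, ?_⟩
  · simpa [Function.comp_def] using tendsto_inv_atTop_zero.comp (tendsto_pow_atTop (two_ne_zero (α := ℕ)) (α := ℝ))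
  · filter_upwards [eventually_ge_atTop (4 : ℝ)] with T hT x hx t ht
    have := norm_poleKernel_le (x := x) (t := t) (by rw [hx]; exact hT)
    rwa [← sq_abs x, hx] at this

lemma integral_poleKernel_line_eq_of_le {t u : ℝ} (ht : 0 < t) (htu : t ≤ u) (hu : u < 2) :
    ∫ x : ℝ, poleKernel (x + t * I) = ∫ x : ℝ, poleKernel (x + u * I) := by
  refine integral_horizontal_eq htu (fun z hz => ?_) (stripDecay_poleKernel _ _)
    (integrable_poleKernel_line ht.ne' (abs_lt.mpr ⟨by linarith, by linarith⟩))
    (integrable_poleKernel_line (by linarith) (abs_lt.mpr ⟨by linarith, by linarith⟩))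
  have hz1 : t ≤ z.im := hz.1
  have hz2 : z.im ≤ u := hz.2
  have h0 : z ≠ 0 := fun h => by rw [h, zero_im] at hz1; linarith
  have h4 := sq_add_four_ne_zero (z := z) (abs_lt.mpr ⟨by linarith, by linarith⟩)
  unfold poleKernel
  have : DifferentiableAt ℂ (fun z : ℂ => z * (z ^ 2 + 4)) z := by fun_prop
  exact ((differentiableAt_const _).div this (mul_ne_zero h0 h4)).differentiableWithinAt

lemma integral_poleKernel_line_of_pos {t : ℝ} (h0 : 0 < t) (ht : t < 2) :
    ∫ x : ℝ, poleKernel (x + t * I) = -(Real.pi * I) := by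
  rw [← integral_poleKernel_line_one]
  rcases le_total t 1 with h | h
  · exact integral_poleKernel_line_eq_of_le h0 h (by norm_num)
  · exact (integral_poleKernel_line_eq_of_le one_pos h ht).symm

lemma integral_poleKernel_line_of_neg {t : ℝ} (h0 : t < 0) (ht : -2 < t) :
    ∫ x : ℝ, poleKernel (x + t * I) = Real.pi * I := by
  rw [← integral_neg_eq_self, ← neg_inj, ← integral_neg,
    ← integral_poleKernel_line_of_pos (t := -t) (by linarith) (by linarith)]
  refine integral_congr_ae (Eventually.of_forall fun x => ?_)
  simp only [← poleKernel_neg]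
  congr 1
  push_cast; ring

lemma StripDecay.add {F G : ℂ → ℂ} {a b : ℝ} (hF : StripDecay F a b) (hG : StripDecay G a b) :
    StripDecay (fun z => F z + G z) a b := by
  obtain ⟨B, hB, h⟩ := hF
  obtain ⟨C, hC, k⟩ := hG
  refine ⟨fun x => B x + C x, by simpa using hB.add hC, ?_⟩
  filter_upwards [h, k] with T hT kT x hx t ht
  exact (norm_add_le _ _).trans (add_le_add (hT x hx t ht) (kT x hx t ht))

lemma StripDecay.const_mul {F : ℂ → ℂ} {a b : ℝ} (hF : StripDecay F a b) (c : ℂ) :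
    StripDecay (fun z => c * F z) a b := by
  obtain ⟨B, hB, h⟩ := hF
  refine ⟨fun x => ‖c‖ * B x, by simpa using hB.const_mul ‖c‖, ?_⟩
  filter_upwards [h] with T hT x hx t ht
  rw [norm_mul]
  exact mul_le_mul_of_nonneg_left (hT x hx t ht) (norm_nonneg _)

lemma StripDecay.congr {F G : ℂ → ℂ} {a b : ℝ} (hF : StripDecay F a b)
    (h : ∀ z ∈ strip a b, z ≠ 0 → G z = F z) : StripDecay G a b := by
  obtain ⟨B, hB, k⟩ := hF
  refine ⟨B, hB, ?_⟩
  filter_upwards [k, eventually_gt_atTop 0] with T hT hT0 x hx t ht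
  rw [h _ (by simpa [strip] using ht)]
  · exact hT x hx t ht
  · intro h0
    have : x = 0 := by simpa using congrArg Complex.re h0
    rw [this, abs_zero] at hx
    linarith

/-- Residue theorem for a horizontal strip: crossing a simple pole at the origin. -/
theorem integral_horizontal_sub_eq_residue {H : ℂ → ℂ} {a b : ℝ} (ha : -2 < a) (ha0 : a < 0)
    (hb0 : 0 < b) (hb : b < 2) (hd : DifferentiableOn ℂ H (strip a b))
    (hdec : StripDecay (fun z => H z / z) a b)
    (hia : Integrable fun x : ℝ => H (x + a * I) / (x + a * I))
    (hib : Integrable fun x : ℝ => H (x + b * I) / (x + b * I)) :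
    (∫ x : ℝ, H (x + a * I) / (x + a * I)) - ∫ x : ℝ, H (x + b * I) / (x + b * I)
      = 2 * Real.pi * I * H 0 := by
  have hstrip : ∀ z ∈ strip a b, |z.im| < 2 := fun z hz =>
    abs_lt.mpr ⟨by linarith [hz.1], by linarith [hz.2]⟩
  -- Off 0 this is H(z)/z - H(0)·`poleKernel z`; `dslope` fills in the removable singularity.
  set Q : ℂ → ℂ := fun z => dslope H 0 z + H 0 * (z / (z ^ 2 + 4)) with hQ
  have hQeq : ∀ z ∈ strip a b, z ≠ 0 → Q z = H z / z + (-H 0) * poleKernel z := by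
    intro z hz h0
    rw [poleKernel_eq h0 (hstrip z hz), hQ]
    simp only
    rw [dslope_of_ne _ h0, slope_def_field, sub_zero]
    ring
  have hnhds : strip a b ∈ 𝓝 (0 : ℂ) :=
    (continuous_im.tendsto 0).eventually (Icc_mem_nhds (by simpa using ha0) (by simpa using hb0))
  have hQd : DifferentiableOn ℂ Q (strip a b) := by
    refine ((Complex.differentiableOn_dslope hnhds).mpr hd).add fun z hz => ?_
    have := sq_add_four_ne_zero (hstrip z hz)
    have h1 : DifferentiableAt ℂ (fun z : ℂ => z ^ 2 + 4) z := by fun_prop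
    exact ((differentiableAt_fun_id.div h1 this).const_mul _).differentiableWithinAt
  have hQdec : StripDecay Q a b :=
    (hdec.add ((stripDecay_poleKernel a b).const_mul (-H 0))).congr hQeq
  have hline : ∀ t ∈ Icc a b, t ≠ 0 → ∀ x : ℝ, Q (x + t * I) =
      H (x + t * I) / (x + t * I) + (-H 0) * poleKernel (x + t * I) := by
    intro t ht h0 x
    refine hQeq _ (by simpa [strip] using ht) fun h => h0 ?_
    simpa using congrArg Complex.im h
  have hLa := hline a ⟨le_rfl, by linarith⟩ ha0.ne
  have hLb := hline b ⟨by linarith, le_rfl⟩ hb0.ne'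
  have hKa := (integrable_poleKernel_line ha0.ne (abs_lt.mpr ⟨ha, by linarith⟩)).const_mul (-H 0)
  have hKb := (integrable_poleKernel_line hb0.ne' (abs_lt.mpr ⟨by linarith, hb⟩)).const_mul (-H 0)
  have key := integral_horizontal_eq (by linarith) hQd hQdec
    (by simp only [hLa]; exact hia.add hKa) (by simp only [hLb]; exact hib.add hKb)
  simp only [hLa, hLb] at key
  rw [integral_add hia hKa, integral_add hib hKb, integral_const_mul, integral_const_mul,
    integral_poleKernel_line_of_neg ha0 ha, integral_poleKernel_line_of_pos hb0 hb] at key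
  linear_combination key

/-! ### The denominator -/

/-- The denominator `e^{π i x} - e^{-π i x}`. -/
def den (x : ℂ) : ℂ :=
  Complex.exp (Real.pi * Complex.I * x) - Complex.exp (-(Real.pi * Complex.I * x))

lemma integrandSW_eq (s x : ℂ) :
    integrandSW s x = x ^ (-s) * exp (Real.pi * I * x ^ 2) / den x := rfl

lemma integrandSE_eq (s x : ℂ) :
    integrandSE s x = x ^ (s - 1) * exp (-(Real.pi * I * x ^ 2)) / den x := rfl

lemma differentiable_den : Differentiable ℂ den := by unfold den; fun_prop

lemma continuous_den : Continuous den := differentiable_den.continuous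

lemma den_neg (x : ℂ) : den (-x) = -den x := by simp [den]

lemma den_eq_sin (x : ℂ) : den x = 2 * I * sin (Real.pi * x) := by
  rw [den, Complex.sin, show -((Real.pi : ℂ) * I * x) = -(Real.pi * x) * I by ring,
    show (Real.pi : ℂ) * I * x = Real.pi * x * I by ring]
  linear_combination (-exp (-(Real.pi * x) * I) + exp (Real.pi * x * I)) * I_sq

lemma den_ne_zero {x : ℂ} (h : ∀ n : ℤ, x ≠ n) : den x ≠ 0 := by
  rw [den_eq_sin]
  refine mul_ne_zero (by simp) fun h0 => ?_
  obtain ⟨k, hk⟩ := Complex.sin_eq_zero_iff.mp h0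
  refine h k (mul_left_cancel₀ (ofReal_ne_zero.mpr Real.pi_ne_zero) ?_)
  rw [hk, mul_comm]

/-- Source of the lower bounds for `den`: sinh controls it away from the real axis, and sin together
with sinh near the origin. -/
lemma normSq_sin (z : ℂ) : normSq (sin z) = Real.sin z.re ^ 2 + Real.sinh z.im ^ 2 := by
  have h : sin z = ((Real.sin z.re * Real.cosh z.im : ℝ) : ℂ)
      + ((Real.cos z.re * Real.sinh z.im : ℝ) : ℂ) * I := by
    rw [Complex.sin_eq]; push_cast; ring
  rw [h, normSq_add_mul_I]
  linear_combination Real.sin z.re ^ 2 * Real.cosh_sq z.im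
    + Real.sinh z.im ^ 2 * Real.cos_sq' z.re

lemma sq_le_sinh_sq (b : ℝ) : b ^ 2 ≤ Real.sinh b ^ 2 := by
  rw [sq_le_sq, Real.abs_sinh]
  exact Real.self_le_sinh_iff.mpr (abs_nonneg b)

lemma norm_den_sq (x : ℂ) :
    ‖den x‖ ^ 2 = 4 * (Real.sin (Real.pi * x.re) ^ 2 + Real.sinh (Real.pi * x.im) ^ 2) := by
  have h := normSq_sin (Real.pi * x)
  rw [re_ofReal_mul, im_ofReal_mul] at h
  rw [den_eq_sin, norm_mul, mul_pow, ← normSq_eq_norm_sq (sin _), h]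
  simp; norm_num

lemma two_pi_mul_abs_im_le_norm_den (x : ℂ) : 2 * Real.pi * |x.im| ≤ ‖den x‖ := by
  refine le_of_sq_le_sq ?_ (norm_nonneg _)
  rw [norm_den_sq, mul_pow, sq_abs]
  nlinarith [sq_le_sinh_sq (Real.pi * x.im), sq_nonneg (Real.sin (Real.pi * x.re))]

/-- Jordan's inequality bounds the sine part, |sinh b| ≥ |b| the other; this shows that the zero of
`den` at 0 is simple, quantitatively. -/
lemma four_mul_norm_le_norm_den {x : ℂ} (hx : |x.re| ≤ 1 / 2) : 4 * ‖x‖ ≤ ‖den x‖ := by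
  refine le_of_sq_le_sq ?_ (norm_nonneg _)
  have h1 : 2 * |x.re| ≤ |Real.sin (Real.pi * x.re)| := by
    have h := Real.mul_abs_le_abs_sin (x := Real.pi * x.re) (by
      rw [abs_mul, abs_of_pos Real.pi_pos]; nlinarith [Real.pi_pos])
    rw [abs_mul, abs_of_pos Real.pi_pos] at h
    calc 2 * |x.re| = 2 / Real.pi * (Real.pi * |x.re|) := by field_simp
      _ ≤ _ := h
  have h2 : 4 * x.re ^ 2 ≤ Real.sin (Real.pi * x.re) ^ 2 := by
    rw [← sq_abs x.re, ← sq_abs (Real.sin _)]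
    nlinarith [abs_nonneg x.re]
  have h3 := sq_le_sinh_sq (Real.pi * x.im)
  have h4 : 9 ≤ Real.pi ^ 2 := by nlinarith [Real.pi_gt_three]
  rw [norm_den_sq, mul_pow, ← normSq_eq_norm_sq, normSq_apply]
  nlinarith [sq_nonneg x.im, mul_le_mul_of_nonneg_right h4 (sq_nonneg x.im)]

/-! ### Gaussian domination -/

/-- Completing the square. All integrands below are bounded in this shape: powers and linear
exponents cost e^{K + K|x|}, which the Gaussian absorbs. -/
lemma gauss_exponent_le (K x : ℝ) :
    Real.exp (K + K * |x| - Real.pi * x ^ 2) ≤ Real.exp (K + K ^ 2 / 4) * Real.exp (-1 * x ^ 2) := by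
  rw [← Real.exp_add]
  apply Real.exp_le_exp.mpr
  have h : 0 ≤ (K / 2 - |x|) ^ 2 := sq_nonneg _
  have h2 : (3 - 2) * x ^ 2 ≤ (Real.pi - 2) * x ^ 2 := by
    have := Real.pi_gt_three
    gcongr
  nlinarith [sq_abs x]

lemma integrable_gauss (K : ℝ) :
    Integrable fun x : ℝ => Real.exp (K + K * |x| - Real.pi * x ^ 2) := by
  refine ((integrable_exp_neg_mul_sq one_pos).const_mul (Real.exp (K + K ^ 2 / 4))).mono'
    (by fun_prop) (Eventually.of_forall fun x => ?_)
  rw [Real.norm_of_nonneg (Real.exp_pos _).le]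
  exact gauss_exponent_le K x

/-- A continuous function with a Gaussian bound near infinity is integrable. -/
lemma integrable_of_gauss {E : Type*} [NormedAddCommGroup E] {f : ℝ → E} (hf : Continuous f) {K T : ℝ}
    (h : ∀ x, T ≤ |x| → ‖f x‖ ≤ Real.exp (K + K * |x| - Real.pi * x ^ 2)) : Integrable f := by
  refine hf.locallyIntegrable.integrable_of_isBigO_cocompact ?_
    ((integrable_gauss K).integrableAtFilter _)
  refine Asymptotics.IsBigO.of_bound 1 ?_
  have : ∀ᶠ x : ℝ in cocompact ℝ, T ≤ |x| := by
    simpa using (tendsto_norm_cocompact_atTop (E := ℝ)).eventually_ge_atTop T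
  filter_upwards [this] with x hx
  rw [one_mul, Real.norm_of_nonneg (Real.exp_pos _).le]
  exact h x hx

lemma stripDecay_of_gauss {G : ℂ → ℂ} {a b K T : ℝ}
    (h : ∀ x : ℝ, T ≤ |x| → ∀ t ∈ Icc a b,
      ‖G (x + t * I)‖ ≤ Real.exp (K + K * |x| - Real.pi * x ^ 2)) : StripDecay G a b := by
  refine ⟨fun x => Real.exp (K + K ^ 2 / 4) * Real.exp (-1 * x ^ 2), ?_, ?_⟩
  · rw [← mul_zero (Real.exp (K + K ^ 2 / 4))]
    refine (Real.tendsto_exp_atBot.comp ?_).const_mul _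
    exact (tendsto_pow_atTop (two_ne_zero (α := ℕ))).const_mul_atTop_of_neg (by norm_num)
  · filter_upwards [eventually_ge_atTop T] with S hS x hx t ht
    have := (h x (hx ▸ hS) t ht).trans (gauss_exponent_le K x)
    rwa [← sq_abs x, hx] at this

/-! ### The two directions -/

lemma exp_pi_div_four : exp (Real.pi * I / 4) = (√2 / 2 : ℝ) * (1 + I) := by
  rw [show (Real.pi : ℂ) * I / 4 = (Real.pi / 4 : ℝ) * I by push_cast; ring, exp_mul_I,
    ← ofReal_cos, ← ofReal_sin, Real.cos_pi_div_four, Real.sin_pi_div_four]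
  ring

lemma dirSW_eq : dirSW = -((√2 / 2 : ℝ) * (1 + I)) := by rw [dirSW, exp_pi_div_four]

lemma dirSE_eq : dirSE = (√2 / 2 : ℝ) * (1 - I) := by
  have h : dirSE = (starRingEnd ℂ) (exp (Real.pi * I / 4)) := by
    rw [dirSE, ← exp_conj]; congr 1; simp [neg_div]; rw [map_ofNat]
  rw [h, exp_pi_div_four]
  simp only [map_mul, conj_ofReal, map_add, map_one, conj_I]
  ring

lemma half_sqrt_two_sq : ((√2 / 2 : ℝ) : ℂ) ^ 2 = 1 / 2 := by
  have : (√2 / 2 : ℝ) ^ 2 = 1 / 2 := by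
    rw [div_pow, Real.sq_sqrt (by norm_num)]; norm_num
  rw [← ofReal_pow, this]; push_cast; rfl

lemma half_sqrt_two_pos : 0 < √2 / 2 := by positivity

lemma half_sqrt_two_gt : 1 / 2 < √2 / 2 := by
  have : (1 : ℝ) < √2 := Real.lt_sqrt_of_sq_lt (by norm_num)
  linarith

lemma half_sqrt_two_lt : √2 / 2 < 1 := by
  have : √2 < 2 := by
    rw [Real.sqrt_lt' (by norm_num)]; norm_num
  linarith

lemma sqrt_two_mul_half : √2 * (√2 / 2) = 1 := by
  have := Real.mul_self_sqrt (show (0 : ℝ) ≤ 2 by norm_num)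
  linarith

lemma dirSW_sq : dirSW ^ 2 = I := by
  rw [dirSW_eq, neg_sq, mul_pow, half_sqrt_two_sq]
  linear_combination (1 / 2 : ℂ) * I_sq

lemma dirSE_sq : dirSE ^ 2 = -I := by
  rw [dirSE_eq, mul_pow, half_sqrt_two_sq]
  linear_combination (1 / 2 : ℂ) * I_sq

lemma norm_dirSW : ‖dirSW‖ = 1 := by
  rw [dirSW, norm_neg, show (Real.pi : ℂ) * I / 4 = (Real.pi / 4 : ℝ) * I by push_cast; ring,
    norm_exp_ofReal_mul_I]

lemma mul_dirSW_re (x t : ℝ) : ((x + t * I) * dirSW).re = √2 / 2 * (t - x) := by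
  simp [dirSW_eq]; ring

lemma mul_dirSW_im (x t : ℝ) : ((x + t * I) * dirSW).im = -(√2 / 2 * (x + t)) := by
  simp [dirSW_eq]; ring

/-- The point `c` in the coordinate along and across the direction `↙`. -/
lemma ofReal_add_mul_dirSW (c y : ℝ) :
    (c : ℂ) + y * dirSW = (((y + -(√2 / 2 * c) : ℝ) : ℂ) + (√2 / 2 * c : ℝ) * I) * dirSW := by
  have h := half_sqrt_two_sq
  push_cast at h
  rw [dirSW_eq]
  push_cast
  linear_combination (-2 * c : ℂ) * h + c * (√2 / 2 : ℂ) ^ 2 * I_sq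

/-- The line meets the real axis only at x = -t, where the real part is √2·t > 0. -/
lemma mul_dirSW_mem_slitPlane (x : ℝ) {t : ℝ} (ht : 0 < t) :
    (x + t * I) * dirSW ∈ slitPlane := by
  rw [mem_slitPlane_iff, mul_dirSW_re, mul_dirSW_im]
  by_cases h : x + t = 0
  · left
    have : x = -t := by linarith
    subst this
    have := half_sqrt_two_pos
    apply mul_pos this; linarith
  · right
    exact neg_ne_zero.mpr (mul_ne_zero half_sqrt_two_pos.ne' h)

/-- Zeros of `den` are integers, and the only real point of the line is √2·t ∈ (0, 1). -/
lemma den_mul_dirSW_ne_zero (x : ℝ) {t : ℝ} (ht : 0 < t) (ht1 : t < √2 / 2) :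
    den ((x + t * I) * dirSW) ≠ 0 := by
  refine den_ne_zero fun n hn => ?_
  have him := mul_dirSW_im x t
  have hre := mul_dirSW_re x t
  rw [hn] at him hre
  simp only [intCast_im, intCast_re] at him hre
  have hx : x = -t := by
    have : √2 / 2 * (x + t) = 0 := by linarith
    rcases mul_eq_zero.mp this with h | h
    · exact absurd h half_sqrt_two_pos.ne'
    · linarith
  subst hx
  have h1 : (n : ℝ) = √2 * t := by rw [hre]; ring
  have h2 : √2 * t < 1 := by
    rw [← sqrt_two_mul_half]; gcongr
  have h3 : 0 < √2 * t := by positivity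
  rw [← h1] at h2 h3
  have h4 : n < 1 := by exact_mod_cast h2
  have h5 : 0 < n := by exact_mod_cast h3
  omega

/-! ### The integrand of `𝔣` along its lines -/

/-- The weight `e^{π i x²} / (e^{π i x} - e^{-π i x})`. -/
def weightSW (x : ℂ) : ℂ := exp (Real.pi * I * x ^ 2) / den x

lemma integrandSW_eq_weight (s x : ℂ) : integrandSW s x = x ^ (-s) * weightSW x := by
  rw [integrandSW_eq, weightSW, mul_div_assoc]

/-- Since `dirSW ^ 2 = I`, the exponent πix² is -πw² in the coordinate w = x + ti. -/
lemma norm_exp_mul_dirSW (x t : ℝ) :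
    ‖exp (Real.pi * I * ((x + t * I) * dirSW) ^ 2)‖ = Real.exp (Real.pi * t ^ 2 - Real.pi * x ^ 2) := by
  rw [mul_pow, dirSW_sq, norm_exp]
  congr 1
  rw [show (Real.pi : ℂ) * I * ((x + t * I) ^ 2 * I)
    = ((Real.pi * t ^ 2 - Real.pi * x ^ 2 : ℝ) : ℂ) + ((-2 * Real.pi * x * t : ℝ) : ℂ) * I by
      push_cast; linear_combination (Real.pi * (x + t * I) ^ 2 - Real.pi * t ^ 2 : ℂ) * I_sq]
  simp only [add_re, ofReal_re, re_ofReal_mul, I_re, mul_zero, add_zero]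

lemma one_le_norm_den_mul_dirSW {x t : ℝ} (hx : 2 ≤ |x|) (ht : |t| ≤ 1) :
    1 ≤ ‖den ((x + t * I) * dirSW)‖ := by
  refine le_trans ?_ (two_pi_mul_abs_im_le_norm_den _)
  rw [mul_dirSW_im, abs_neg, abs_mul, abs_of_pos half_sqrt_two_pos]
  have h1 : 1 ≤ |x + t| := by
    have := abs_sub_abs_le_abs_sub x (-t)
    rw [abs_neg, sub_neg_eq_add] at this
    linarith
  have h2 := half_sqrt_two_gt
  have h3 := Real.pi_gt_three
  calc (1 : ℝ) ≤ 2 * 3 * (1 / 2 * 1) := by norm_num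
    _ ≤ _ := by gcongr

lemma norm_weightSW_le {x t : ℝ} (hx : 2 ≤ |x|) (ht : |t| ≤ 1) :
    ‖weightSW ((x + t * I) * dirSW)‖ ≤ Real.exp (Real.pi - Real.pi * x ^ 2) := by
  rw [weightSW, norm_div, norm_exp_mul_dirSW]
  refine (div_le_self (Real.exp_pos _).le (one_le_norm_den_mul_dirSW hx ht)).trans ?_
  apply Real.exp_le_exp.mpr
  have : t ^ 2 ≤ 1 := by rw [← sq_abs]; nlinarith [abs_nonneg t]
  nlinarith [Real.pi_pos]

lemma norm_log_mul_dirSW_le {x t a : ℝ} (ha : 0 < a) (hat : a ≤ t) (ht : t ≤ 1) :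
    ‖log ((x + t * I) * dirSW)‖ ≤ (|Real.log a| + 1 + Real.pi) + |x| := by
  set z : ℂ := (x + t * I) * dirSW
  have hz : ‖z‖ = ‖(x + t * I : ℂ)‖ := by rw [norm_mul, norm_dirSW, mul_one]
  have h1 : t ≤ ‖z‖ := by
    rw [hz]
    have := abs_im_le_norm (x + t * I : ℂ)
    simp at this
    exact (le_abs_self t).trans this
  have h2 : ‖z‖ ≤ |x| + 1 := by
    rw [hz]
    refine (norm_add_le _ _).trans ?_
    rw [norm_mul, norm_I, mul_one, norm_real, norm_real, Real.norm_eq_abs, Real.norm_eq_abs,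
      abs_of_pos (ha.trans_le hat)]
    linarith
  have hz0 : 0 < ‖z‖ := by linarith
  have h3 : ‖log z‖ ≤ |Real.log ‖z‖| + |arg z| := by
    refine (norm_le_abs_re_add_abs_im _).trans ?_
    rw [log_re, log_im]
  have h4 : |Real.log ‖z‖| ≤ |Real.log a| + 1 + |x| := by
    rw [abs_le]
    constructor
    · have : Real.log a ≤ Real.log ‖z‖ := Real.log_le_log ha (hat.trans h1)
      linarith [neg_abs_le (Real.log a), abs_nonneg x]
    · linarith [Real.log_le_sub_one_of_pos hz0, abs_nonneg (Real.log a)]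
  linarith [abs_arg_le_pi z]

lemma norm_cpow_le_exp_log {z : ℂ} (hz : z ≠ 0) (s : ℂ) :
    ‖z ^ s‖ ≤ Real.exp (‖s‖ * ‖log z‖) := by
  rw [cpow_def_of_ne_zero hz, mul_comm ‖s‖, ← norm_mul]
  exact norm_exp_le_exp_norm _

lemma exp_log_mul_weightSW_le {M a : ℝ} (hM : 0 ≤ M) (ha : 0 < a) {x t : ℝ} (hx : 2 ≤ |x|)
    (hat : a ≤ t) (ht : t ≤ 1) :
    Real.exp (M * ‖log ((x + t * I) * dirSW)‖) * ‖weightSW ((x + t * I) * dirSW)‖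
      ≤ Real.exp ((M * (|Real.log a| + 1 + Real.pi) + Real.pi + M)
        + (M * (|Real.log a| + 1 + Real.pi) + Real.pi + M) * |x| - Real.pi * x ^ 2) := by
  have h1 := norm_log_mul_dirSW_le (x := x) ha hat ht
  have h2 := norm_weightSW_le (x := x) (t := t) hx (by rw [abs_of_pos (by linarith)]; exact ht)
  calc _ ≤ Real.exp (M * ((|Real.log a| + 1 + Real.pi) + |x|))
        * Real.exp (Real.pi - Real.pi * x ^ 2) := by gcongr
    _ ≤ _ := by
      rw [← Real.exp_add]
      apply Real.exp_le_exp.mpr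
      have : 0 ≤ (M * (|Real.log a| + 1 + Real.pi) + Real.pi) * |x| := by
        have := Real.pi_pos; positivity
      linarith

lemma continuous_log_line {t : ℝ} (ht : 0 < t) :
    Continuous fun x : ℝ => log ((x + t * I) * dirSW) :=
  Continuous.clog (by fun_prop) fun x => mul_dirSW_mem_slitPlane x ht

lemma continuous_weightSW_line {t : ℝ} (ht : 0 < t) (ht1 : t < √2 / 2) :
    Continuous fun x : ℝ => weightSW ((x + t * I) * dirSW) := by
  unfold weightSW
  exact Continuous.div (by fun_prop) (continuous_den.comp (by fun_prop))
    fun x => den_mul_dirSW_ne_zero x ht ht1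

lemma continuous_integrandSW_line (s : ℂ) {t : ℝ} (ht : 0 < t) (ht1 : t < √2 / 2) :
    Continuous fun x : ℝ => integrandSW s ((x + t * I) * dirSW) := by
  simp only [integrandSW_eq_weight]
  exact (Continuous.cpow (by fun_prop) continuous_const fun x =>
    mul_dirSW_mem_slitPlane x ht).mul (continuous_weightSW_line ht ht1)

lemma norm_integrandSW_le (s : ℂ) {a : ℝ} (ha : 0 < a) {x t : ℝ} (hx : 2 ≤ |x|)
    (hat : a ≤ t) (ht : t ≤ 1) :
    ‖integrandSW s ((x + t * I) * dirSW)‖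
      ≤ Real.exp ((‖s‖ * (|Real.log a| + 1 + Real.pi) + Real.pi + ‖s‖)
        + (‖s‖ * (|Real.log a| + 1 + Real.pi) + Real.pi + ‖s‖) * |x| - Real.pi * x ^ 2) := by
  refine le_trans ?_ (exp_log_mul_weightSW_le (norm_nonneg s) ha hx hat ht)
  rw [integrandSW_eq_weight, norm_mul]
  gcongr
  simpa using norm_cpow_le_exp_log
    (slitPlane_ne_zero (mul_dirSW_mem_slitPlane x (ha.trans_le hat))) (-s)

lemma integrable_integrandSW_line (s : ℂ) {t : ℝ} (ht : 0 < t) (ht1 : t < √2 / 2) :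
    Integrable fun x : ℝ => integrandSW s ((x + t * I) * dirSW) :=
  integrable_of_gauss (continuous_integrandSW_line s ht ht1) fun _ hx =>
    norm_integrandSW_le s ht hx le_rfl (ht1.trans half_sqrt_two_lt).le

lemma scaled_mem {c : ℝ} (hc : c ∈ Ioo (0 : ℝ) 1) : 0 < √2 / 2 * c ∧ √2 / 2 * c < √2 / 2 :=
  ⟨mul_pos half_sqrt_two_pos hc.1, by nlinarith [hc.2, half_sqrt_two_pos]⟩

theorem lineIntegrable_integrandSW {c : ℝ} (hc : c ∈ Ioo (0 : ℝ) 1) (s : ℂ) :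
    LineIntegrable (integrandSW s) c dirSW := by
  have h := integrable_integrandSW_line s (scaled_mem hc).1 (scaled_mem hc).2
  unfold LineIntegrable
  simp_rw [ofReal_add_mul_dirSW]
  exact (h.comp_add_right (-(√2 / 2 * c))).mul_const _

theorem frakF_eq (c : ℝ) (s : ℂ) :
    frakF c s = (∫ x : ℝ, integrandSW s ((x + (√2 / 2 * c : ℝ) * I) * dirSW)) * dirSW := by
  unfold frakF lineIntegral
  simp_rw [ofReal_add_mul_dirSW]
  rw [integral_mul_const, integral_add_right_eq_self
    (fun x : ℝ => integrandSW s ((x + (√2 / 2 * c : ℝ) * I) * dirSW))]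

theorem differentiable_frakF {c : ℝ} (hc : c ∈ Ioo (0 : ℝ) 1) : Differentiable ℂ (frakF c) := by
  obtain ⟨ht, ht1⟩ := scaled_mem hc
  set t := √2 / 2 * c
  have hne : ∀ x : ℝ, (x + t * I) * dirSW ≠ 0 := fun x =>
    slitPlane_ne_zero (mul_dirSW_mem_slitPlane x ht)
  intro s
  suffices h : DifferentiableAt ℂ
      (fun s => ∫ x : ℝ, integrandSW s ((x + t * I) * dirSW)) s by
    rw [show frakF c = _ from funext (frakF_eq c)]
    exact h.mul_const _
  -- On the unit ball ‖s'‖ < ‖s‖ + 1; the extra 1 absorbs the factor log from the derivative, via L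
  -- ≤ e^L.
  set M := ‖s‖ + 2 with hM
  have hM0 : 0 ≤ M := by positivity
  have hbound : Integrable fun x : ℝ =>
      Real.exp (M * ‖log ((x + t * I) * dirSW)‖) * ‖weightSW ((x + t * I) * dirSW)‖ := by
    have h1 := continuous_log_line ht
    have h2 := continuous_weightSW_line ht ht1
    refine integrable_of_gauss (K := M * (|Real.log t| + 1 + Real.pi) + Real.pi + M) (T := 2)
      (by fun_prop) fun x hx => ?_
    rw [Real.norm_of_nonneg (by positivity)]
    exact exp_log_mul_weightSW_le hM0 ht hx le_rfl (ht1.trans half_sqrt_two_lt).le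
  refine (hasDerivAt_integral_of_dominated_loc_of_deriv_le (𝕜 := ℂ)
    (F := fun s (x : ℝ) => integrandSW s ((x + t * I) * dirSW))
    (F' := fun s (x : ℝ) => -log ((x + t * I) * dirSW) * integrandSW s ((x + t * I) * dirSW))
    (bound := fun x : ℝ =>
      Real.exp (M * ‖log ((x + t * I) * dirSW)‖) * ‖weightSW ((x + t * I) * dirSW)‖)
    (Metric.ball_mem_nhds s one_pos) ?_ (integrable_integrandSW_line s ht ht1) ?_ ?_ ?_
    ?_).2.differentiableAt
  · exact Eventually.of_forall fun s => (continuous_integrandSW_line s ht ht1).aestronglyMeasurable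
  · exact ((continuous_log_line ht).neg.mul
      (continuous_integrandSW_line s ht ht1)).aestronglyMeasurable
  · refine Eventually.of_forall fun x s' hs' => ?_
    rw [norm_mul, norm_neg, integrandSW_eq_weight, norm_mul, ← mul_assoc]
    gcongr
    set L := ‖log ((x + t * I) * dirSW)‖
    have h1 : ‖((x + t * I) * dirSW) ^ (-s')‖ ≤ Real.exp (‖s'‖ * L) := by
      simpa using norm_cpow_le_exp_log (hne x) (-s')
    have h2 : L ≤ Real.exp L := by linarith [Real.add_one_le_exp L]
    have h3 : ‖s'‖ ≤ ‖s‖ + 1 := by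
      have := norm_le_norm_add_norm_sub s s'
      rw [mem_ball_iff_norm'] at hs'
      linarith
    calc L * ‖((x + t * I) * dirSW) ^ (-s')‖ ≤ Real.exp L * Real.exp (‖s'‖ * L) := by gcongr
      _ ≤ _ := by
        rw [← Real.exp_add]
        apply Real.exp_le_exp.mpr
        have : 0 ≤ L := norm_nonneg _
        nlinarith
  · exact hbound
  · refine Eventually.of_forall fun x s' _ => ?_
    simp only [integrandSW_eq_weight]
    have := ((hasDerivAt_neg s').const_cpow (c := (x + t * I) * dirSW) (Or.inl (hne x))).mul_const
      (weightSW ((x + t * I) * dirSW))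
    refine this.congr_deriv ?_
    ring

/-! ### Complex conjugation exchanges `𝔣` and `𝔤` -/

local notation "conj" => starRingEnd ℂ

lemma conj_dirSW : conj dirSW = -dirSE := by
  rw [dirSW_eq, dirSE_eq]
  simp only [map_neg, map_mul, conj_ofReal, map_add, map_one, conj_I]
  ring

lemma conj_den (x : ℂ) : conj (den x) = -den (conj x) := by
  simp only [den, map_sub, ← exp_conj, map_neg, map_mul, conj_ofReal, conj_I]
  ring_nf

lemma integrandSE_conj (s : ℂ) {x : ℂ} (hx : arg x ≠ Real.pi) :
    integrandSE s (conj x) = -conj (integrandSW (1 - conj s) x) := by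
  rw [integrandSE_eq, integrandSW_eq, map_div₀, conj_den, map_mul, ← exp_conj, conj_cpow _ _ hx,
    div_neg, neg_neg]
  simp only [map_sub, map_one, map_mul, conj_ofReal, conj_I, map_pow]
  ring_nf

/-- Conjugation reflects one line into the other with reversed direction, hence `-y`; that sign
cancels the one coming from `den`. -/
lemma integrandSE_line (d : ℝ) (hd : 0 < d) (s : ℂ) (y : ℝ) :
    integrandSE s (d + y * dirSE) * dirSE
      = conj (integrandSW (1 - conj s) (d + (-y : ℝ) * dirSW) * dirSW) := by
  have hmem : (d : ℂ) + (-y : ℝ) * dirSW ∈ slitPlane := by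
    rw [ofReal_add_mul_dirSW]
    exact mul_dirSW_mem_slitPlane _ (mul_pos half_sqrt_two_pos hd)
  have h : (d : ℂ) + y * dirSE = conj ((d : ℂ) + (-y : ℝ) * dirSW) := by
    rw [map_add, map_mul, conj_ofReal, conj_ofReal, conj_dirSW]
    push_cast; ring
  rw [h, integrandSE_conj s (mem_slitPlane_iff_arg.mp hmem).1, map_mul, conj_dirSW]
  ring

theorem lineIntegrable_integrandSE {d : ℝ} (hd : d ∈ Ioo (0 : ℝ) 1) (s : ℂ) :
    LineIntegrable (integrandSE s) d dirSE := by
  have h := (lineIntegrable_integrandSW hd (1 - conj s)).comp_neg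
  unfold LineIntegrable
  simp_rw [integrandSE_line d hd.1]
  exact LinearIsometryEquiv.integrable_comp_iff conjLIE |>.mpr h

theorem frakG_eq_conj {d : ℝ} (hd : 0 < d) (s : ℂ) :
    frakG d s = conj (frakF d (1 - conj s)) := by
  unfold frakG frakF lineIntegral
  simp_rw [integrandSE_line d hd]
  rw [integral_conj, integral_neg_eq_self
    (fun y : ℝ => integrandSW (1 - conj s) (d + y * dirSW) * dirSW) volume]

theorem differentiable_frakG {d : ℝ} (hd : d ∈ Ioo (0 : ℝ) 1) : Differentiable ℂ (frakG d) := by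
  intro s
  have h : frakG d = conj ∘ (fun z => frakF d (1 - z)) ∘ conj := funext fun s => by
    simp [frakG_eq_conj hd.1]
  rw [h]
  have h2 : Differentiable ℂ fun z => frakF d (1 - z) :=
    (differentiable_frakF hd).comp (by fun_prop)
  have := (h2 (conj s)).conj_conj
  rwa [conj_conj] at this

/-! ### Mordell's integral -/

/-- The integrand of Mordell's integral. -/
def mordellIntegrand (u x : ℂ) : ℂ :=
  exp (-(Real.pi * I * x ^ 2) + 2 * Real.pi * I * u * x) / den x

lemma den_add_one (x : ℂ) : den (x + 1) = -den x := by
  have h1 : (Real.pi : ℂ) * I * (x + 1) = Real.pi * I * x + Real.pi * I := by ring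
  rw [den, den, exp_neg, h1, exp_add, exp_pi_mul_I, exp_neg, mul_neg_one, inv_neg]
  ring

/-- Expanding (x + 1)² produces e^{-2πix}, which lowers u by 1; the sign e^{-πi} cancels that of
`den_add_one`. -/
lemma mordellIntegrand_add_one (u x : ℂ) :
    mordellIntegrand u (x + 1) = exp (2 * Real.pi * I * u) * mordellIntegrand (u - 1) x := by
  rw [mordellIntegrand, mordellIntegrand, den_add_one, show
    -((Real.pi : ℂ) * I * (x + 1) ^ 2) + 2 * Real.pi * I * u * (x + 1)
      = 2 * Real.pi * I * u + (-(Real.pi * I * x ^ 2) + 2 * Real.pi * I * (u - 1) * x)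
        + -(Real.pi * I) by ring, exp_add, exp_add, exp_neg (Real.pi * I), exp_pi_mul_I]
  rw [inv_neg, inv_one, mul_neg_one, neg_div_neg_eq, mul_div_assoc]

/-- The two numerators differ by the factor e^{-2πix}, so their difference is a Gaussian times `den
x`. -/
lemma mordellIntegrand_sub (u : ℂ) {x : ℂ} (hx : den x ≠ 0) :
    mordellIntegrand u x - mordellIntegrand (u - 1) x
      = exp (-(Real.pi * I * x ^ 2) + Real.pi * I * (2 * u - 1) * x) := by
  rw [mordellIntegrand, mordellIntegrand, div_sub_div_same, div_eq_iff hx, den,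
    mul_sub (exp _), ← exp_add, ← exp_add]
  congr 2 <;> ring

lemma mul_dirSE_re (x t : ℝ) : ((x + t * I) * dirSE).re = √2 / 2 * (x + t) := by
  simp [dirSE_eq]; ring

lemma mul_dirSE_im (x t : ℝ) : ((x + t * I) * dirSE).im = √2 / 2 * (t - x) := by
  simp [dirSE_eq]; ring

lemma norm_dirSE : ‖dirSE‖ = 1 := by
  rw [← norm_neg, ← conj_dirSW, norm_conj, norm_dirSW]

lemma dirSE_ne_zero : dirSE ≠ 0 := by rw [← norm_ne_zero_iff, norm_dirSE]; exact one_ne_zero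

/-- The shift by 1 places the pole x = 1 at w = 0: the line through d runs below it, the line
through d + 1 above. -/
lemma ofReal_add_mul_dirSE (d y : ℝ) :
    (d : ℂ) + y * dirSE =
      (((y + √2 / 2 * (d - 1) : ℝ) : ℂ) + (√2 / 2 * (d - 1) : ℝ) * I) * dirSE + 1 := by
  have h := half_sqrt_two_sq
  push_cast at h
  rw [dirSE_eq]
  push_cast
  linear_combination (-2 * (d - 1) : ℂ) * h + (d - 1) * (√2 / 2 : ℂ) ^ 2 * I_sq

/-- In the rotated coordinate the integer n lies at height n√2/2, so only n = 0 is in the open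
strip. -/
lemma den_mul_dirSE_ne_zero {w : ℂ} (hw : w ≠ 0) (h : |w.im| < √2 / 2) : den (w * dirSE) ≠ 0 := by
  refine den_ne_zero fun n hn => hw ?_
  have him := mul_dirSE_im w.re w.im
  have hre := mul_dirSE_re w.re w.im
  rw [re_add_im, hn] at him hre
  simp only [intCast_im, intCast_re] at him hre
  have hx : w.im = w.re := by
    rcases mul_eq_zero.mp him.symm with h | h
    · exact absurd h half_sqrt_two_pos.ne'
    · linarith
  have h1 : (n : ℝ) = √2 * w.im := by rw [hre, ← hx]; ring
  have h2 : |(n : ℝ)| < 1 := by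
    rw [h1, abs_mul, abs_of_pos (by positivity), ← sqrt_two_mul_half]; gcongr
  have h4 : n = 0 := by
    have : |n| < 1 := by exact_mod_cast h2
    exact Int.abs_lt_one_iff.mp this
  rw [h4, Int.cast_zero] at h1
  have h5 : w.im = 0 := by
    rcases mul_eq_zero.mp h1.symm with h | h
    · exact absurd h (by positivity)
    · exact h
  exact Complex.ext (hx ▸ h5) h5

lemma norm_mordellIntegrand_le (u : ℂ) {x t : ℝ} (hx : 2 ≤ |x|) (ht : |t| ≤ 1) :
    ‖mordellIntegrand u ((x + t * I) * dirSE + 1)‖ ≤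
      Real.exp ((4 * Real.pi + 4 * Real.pi * ‖u‖) + (4 * Real.pi + 4 * Real.pi * ‖u‖) * |x|
        - Real.pi * x ^ 2) := by
  have hden : 1 ≤ ‖den ((x + t * I) * dirSE + 1)‖ := by
    rw [den_add_one, norm_neg]
    refine le_trans ?_ (two_pi_mul_abs_im_le_norm_den _)
    rw [mul_dirSE_im, abs_mul, abs_of_pos half_sqrt_two_pos]
    have h1 : 1 ≤ |t - x| := by
      have := abs_sub_abs_le_abs_sub x t
      rw [abs_sub_comm t x]
      linarith
    have h2 := half_sqrt_two_gt
    have h3 := Real.pi_gt_three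
    calc (1 : ℝ) ≤ 2 * 3 * (1 / 2 * 1) := by norm_num
      _ ≤ _ := by gcongr
  rw [mordellIntegrand, norm_div]
  refine (div_le_self (norm_nonneg _) hden).trans ?_
  rw [norm_exp]
  apply Real.exp_le_exp.mpr
  set w : ℂ := x + t * I with hw
  have hwn : ‖w‖ ≤ |x| + 1 := by
    refine (norm_add_le _ _).trans ?_
    rw [norm_mul, norm_I, mul_one, norm_real, norm_real, Real.norm_eq_abs, Real.norm_eq_abs]
    linarith
  -- Isolates -πw²; the remaining terms are linear in w and are bounded by their norm.
  have hsplit : -((Real.pi : ℂ) * I * (w * dirSE + 1) ^ 2) + 2 * Real.pi * I * u * (w * dirSE + 1)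
      = (((Real.pi * t ^ 2 - Real.pi * x ^ 2 : ℝ) : ℂ) + ((-2 * Real.pi * x * t : ℝ) : ℂ) * I)
        + Real.pi * I * (2 * u * (w * dirSE + 1) - 2 * w * dirSE - 1) := by
    rw [hw]; push_cast
    linear_combination (-(Real.pi : ℂ) * I * (x + t * I) ^ 2) * dirSE_sq
      + (Real.pi * (x + t * I) ^ 2 - Real.pi * t ^ 2 : ℂ) * I_sq
  rw [hsplit, add_re]
  have h1 : (((Real.pi * t ^ 2 - Real.pi * x ^ 2 : ℝ) : ℂ) + ((-2 * Real.pi * x * t : ℝ) : ℂ) * I).re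
      = Real.pi * t ^ 2 - Real.pi * x ^ 2 := by
    simp only [add_re, ofReal_re, re_ofReal_mul, I_re, mul_zero, add_zero]
  have h2 : ‖(Real.pi : ℂ) * I * (2 * u * (w * dirSE + 1) - 2 * w * dirSE - 1)‖
      ≤ Real.pi * (2 * ‖u‖ * (|x| + 1 + 1) + 2 * (|x| + 1) + 1) := by
    rw [norm_mul, norm_mul, norm_I, norm_real, Real.norm_of_nonneg Real.pi_pos.le, mul_one]
    have hwv : ‖w * dirSE‖ ≤ |x| + 1 := by rwa [norm_mul, norm_dirSE, mul_one]
    have := Real.pi_pos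
    gcongr
    refine (norm_sub_le _ _).trans ?_
    rw [norm_one]
    gcongr
    refine (norm_sub_le _ _).trans ?_
    rw [mul_assoc 2 w, norm_mul, norm_mul, norm_mul 2, norm_ofNat]
    gcongr
    refine (norm_add_le _ _).trans ?_
    rw [norm_one]
    gcongr
  have h3 := (re_le_norm _).trans h2
  rw [h1]
  have ht2 : t ^ 2 ≤ 1 := by rw [← sq_abs]; nlinarith [abs_nonneg t]
  have h4 : 0 ≤ Real.pi * ‖u‖ * |x| := by have := Real.pi_pos; positivity
  have h5 : 0 ≤ Real.pi * |x| := by have := Real.pi_pos; positivity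
  have h6 : Real.pi * t ^ 2 ≤ Real.pi := by nlinarith [Real.pi_pos]
  nlinarith [Real.pi_pos]

lemma abs_lt_half_sqrt_two_of_lines {d t : ℝ} (hd : d ∈ Ioo (0 : ℝ) 1)
    (ht : t ∈ Icc (√2 / 2 * (d - 1)) (√2 / 2 * d)) : |t| < √2 / 2 := by
  have := half_sqrt_two_pos
  obtain ⟨h1, h2⟩ := ht
  obtain ⟨h3, h4⟩ := hd
  rw [abs_lt]
  constructor <;> nlinarith

lemma continuous_mordellIntegrand_line (u : ℂ) {t : ℝ} (h0 : t ≠ 0) (ht : |t| < √2 / 2) :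
    Continuous fun x : ℝ => mordellIntegrand u ((x + t * I) * dirSE + 1) := by
  unfold mordellIntegrand
  refine Continuous.div (by fun_prop) (continuous_den.comp (by fun_prop)) fun x => ?_
  rw [den_add_one]
  refine neg_ne_zero.mpr (den_mul_dirSE_ne_zero (fun h => h0 ?_) (by simpa using ht))
  simpa using congrArg Complex.im h

lemma integrable_mordellIntegrand_line (u : ℂ) {t : ℝ} (h0 : t ≠ 0) (ht : |t| < √2 / 2) :
    Integrable fun x : ℝ => mordellIntegrand u ((x + t * I) * dirSE + 1) :=
  integrable_of_gauss (continuous_mordellIntegrand_line u h0 ht) fun _ hx =>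
    norm_mordellIntegrand_le u hx (ht.trans half_sqrt_two_lt).le

/-- Mordell's integral along the line of direction `↘` through `d`. -/
def mordell (d : ℝ) (u : ℂ) : ℂ := ∫ y : ℝ, mordellIntegrand u (d + y * dirSE)

lemma mordell_eq (d : ℝ) (u : ℂ) : mordell d u =
    ∫ x : ℝ, mordellIntegrand u ((x + (√2 / 2 * (d - 1) : ℝ) * I) * dirSE + 1) := by
  unfold mordell
  simp_rw [ofReal_add_mul_dirSE]
  rw [integral_add_right_eq_self
    (fun x : ℝ => mordellIntegrand u ((x + (√2 / 2 * (d - 1) : ℝ) * I) * dirSE + 1))]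

lemma low_line {d : ℝ} (hd : d ∈ Ioo (0 : ℝ) 1) :
    √2 / 2 * (d - 1) < 0 ∧ |√2 / 2 * (d - 1)| < √2 / 2 := by
  have := half_sqrt_two_pos
  obtain ⟨h3, h4⟩ := hd
  refine ⟨by nlinarith, abs_lt_half_sqrt_two_of_lines ⟨h3, h4⟩ ⟨le_rfl, ?_⟩⟩
  nlinarith

lemma integrable_mordellIntegrand {d : ℝ} (hd : d ∈ Ioo (0 : ℝ) 1) (u : ℂ) :
    Integrable fun y : ℝ => mordellIntegrand u (d + y * dirSE) := by
  simp_rw [ofReal_add_mul_dirSE]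
  exact (integrable_mordellIntegrand_line u (low_line hd).1.ne (low_line hd).2).comp_add_right _

lemma den_lineSE_ne_zero {d : ℝ} (hd : d ∈ Ioo (0 : ℝ) 1) (y : ℝ) : den (d + y * dirSE) ≠ 0 := by
  rw [ofReal_add_mul_dirSE, den_add_one]
  refine neg_ne_zero.mpr (den_mul_dirSE_ne_zero (fun h => (low_line hd).1.ne ?_)
    (by simpa using (low_line hd).2))
  simpa using congrArg Complex.im h

lemma mordell_add_one (d : ℝ) (u : ℂ) :
    mordell (d + 1) u = exp (2 * Real.pi * I * u) * mordell d (u - 1) := by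
  unfold mordell
  rw [← integral_const_mul]
  congr 1; ext y
  rw [← mordellIntegrand_add_one]
  congr 1; push_cast; ring

/-- The Gaussian difference equation of Mordell's integral. -/
lemma mordell_sub {d : ℝ} (hd : d ∈ Ioo (0 : ℝ) 1) (u : ℂ) :
    (mordell d u - mordell d (u - 1)) * dirSE = exp (Real.pi * I * (u ^ 2 - u)) := by
  unfold mordell
  rw [← integral_sub (integrable_mordellIntegrand hd u) (integrable_mordellIntegrand hd _)]
  simp_rw [mordellIntegrand_sub u (den_lineSE_ne_zero hd _)]
  -- The coefficient of y² is -πi·`dirSE ^ 2` = -π, so the Gaussian integral has prefactor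
  -- (π/π)^{1/2} = 1.
  have h := integral_cexp_quadratic (b := -Real.pi) (by simpa using Real.pi_pos)
    (Real.pi * I * dirSE * (2 * u - 1 - 2 * d)) (-(Real.pi * I * d ^ 2) + Real.pi * I * (2 * u - 1) * d)
  have hpi : (Real.pi : ℂ) ≠ 0 := ofReal_ne_zero.mpr Real.pi_ne_zero
  rw [neg_neg, div_self hpi, one_cpow, one_mul] at h
  calc _ = (∫ x : ℝ, exp (-Real.pi * x ^ 2 + Real.pi * I * dirSE * (2 * u - 1 - 2 * d) * x +
        (-(Real.pi * I * d ^ 2) + Real.pi * I * (2 * u - 1) * d))) * dirSE := by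
        congr 2; ext y; congr 1
        linear_combination (-(Real.pi : ℂ) * I * y ^ 2) * dirSE_sq + (Real.pi * y ^ 2 : ℂ) * I_sq
    _ = _ := by
        rw [h, dirSE, ← exp_add]
        congr 1
        have h2 := dirSE_sq
        rw [dirSE] at h2
        field_simp
        linear_combination (4 * I * (u - 1 / 2 - d) ^ 2) * h2 - 4 * (u - 1 / 2 - d) ^ 2 * I_sq

/-- The residue equation of Mordell's integral. -/
lemma mordell_sub_mordell_add_one {d : ℝ} (hd : d ∈ Ioo (0 : ℝ) 1) (u : ℂ) :
    (mordell d u - mordell (d + 1) u) * dirSE = exp (2 * Real.pi * I * u) := by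
  set a := √2 / 2 * (d - 1) with ha
  set b := √2 / 2 * d with hb
  have ha0 : a < 0 := (low_line hd).1
  have hb0 : 0 < b := mul_pos half_sqrt_two_pos hd.1
  have hab : ∀ t ∈ Icc a b, |t| < √2 / 2 := fun t ht => abs_lt_half_sqrt_two_of_lines hd ht
  have hA := hab a ⟨le_rfl, by linarith⟩
  have hB := hab b ⟨by linarith, le_rfl⟩
  have hlt := half_sqrt_two_lt
  -- The denominator divided by w, with its removable singularity filled: E has no zeros on the
  -- strip and E(0) = 2πi·`dirSE`.
  set E : ℂ → ℂ := dslope (fun w => den (w * dirSE)) 0 with hE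
  have hEd : Differentiable ℂ E := by
    rw [hE, ← differentiableOn_univ, Complex.differentiableOn_dslope univ_mem,
      differentiableOn_univ]
    exact differentiable_den.comp (by fun_prop)
  have hE_ne : ∀ w, w ≠ 0 → E w = den (w * dirSE) / w := by
    intro w hw
    rw [hE, dslope_of_ne _ hw, slope_def_field]
    simp [den]
  have hE0 : E 0 = 2 * Real.pi * I * dirSE := by
    rw [hE, dslope_same]
    have h1 : HasDerivAt (fun w : ℂ => Real.pi * I * (w * dirSE)) (Real.pi * I * dirSE) 0 := by
      simpa using ((hasDerivAt_id (0 : ℂ)).mul_const dirSE).const_mul ((Real.pi : ℂ) * I)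
    have h2 := (h1.cexp.sub h1.neg.cexp).deriv
    simp only [den]
    refine h2.trans ?_
    simp; ring
  have hEz : ∀ w ∈ strip a b, E w ≠ 0 := by
    intro w hw
    by_cases h : w = 0
    · rw [h, hE0]
      simp [dirSE_ne_zero, Real.pi_ne_zero]
    · rw [hE_ne w h]
      exact div_ne_zero (den_mul_dirSE_ne_zero h (hab _ hw)) h
  -- The integrand is H(w)/w; the minus sign comes from `den_add_one`.
  set H : ℂ → ℂ := fun w => -exp (-(Real.pi * I * (w * dirSE + 1) ^ 2)
    + 2 * Real.pi * I * u * (w * dirSE + 1)) / E w with hH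
  have hHeq : ∀ w, w ≠ 0 → H w / w = mordellIntegrand u (w * dirSE + 1) := by
    intro w hw
    rw [hH, mordellIntegrand, den_add_one]
    simp only
    rw [hE_ne w hw, div_div, div_mul_cancel₀ _ hw, neg_div, div_neg]
  have hdiff : DifferentiableOn ℂ H (strip a b) := fun w hw =>
    (DifferentiableAt.div (by fun_prop) (hEd w) (hEz w hw)).differentiableWithinAt
  have hdec : StripDecay (fun w => H w / w) a b :=
    (stripDecay_of_gauss (G := fun w => mordellIntegrand u (w * dirSE + 1)) fun x hx t ht =>
      norm_mordellIntegrand_le u hx ((hab t ht).trans hlt).le).congr fun w _ hw => hHeq w hw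
  have hline : ∀ t : ℝ, t ≠ 0 → ∀ x : ℝ, H (x + t * I) / (x + t * I)
      = mordellIntegrand u ((x + t * I) * dirSE + 1) := fun t ht x =>
    hHeq _ fun h => ht (by simpa using congrArg Complex.im h)
  have key := integral_horizontal_sub_eq_residue (H := H) (a := a) (b := b)
    (by linarith [(abs_lt.mp hA).1]) ha0 hb0 (by linarith [(abs_lt.mp hB).2]) hdiff hdec
    (by simp_rw [hline a ha0.ne]; exact integrable_mordellIntegrand_line u ha0.ne hA)
    (by simp_rw [hline b hb0.ne']; exact integrable_mordellIntegrand_line u hb0.ne' hB)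
  simp_rw [hline a ha0.ne, hline b hb0.ne'] at key
  rw [mordell_eq d, mordell_eq (d + 1), add_sub_cancel_right, ← ha, ← hb, key, hH]
  simp only
  rw [hE0, zero_mul, zero_add, one_pow, mul_one, mul_one, exp_add, exp_neg, exp_pi_mul_I]
  have := dirSE_ne_zero
  have hpi : (Real.pi : ℂ) ≠ 0 := ofReal_ne_zero.mpr Real.pi_ne_zero
  field_simp

/-- Mordell's evaluation. -/
theorem mordell_mul_dirSE {d : ℝ} (hd : d ∈ Ioo (0 : ℝ) 1) {u : ℂ} (hu : den u ≠ 0) :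
    mordell d u * dirSE = exp (2 * Real.pi * I * u) / (1 - exp (2 * Real.pi * I * u))
      + exp (Real.pi * I * u ^ 2) / den u := by
  have h1 := mordell_sub hd u
  have h2 := mordell_sub_mordell_add_one hd u
  rw [mordell_add_one] at h2
  -- The two relations become linear equations for Φ(u) and Φ(u-1) with determinant 1 - q².
  set q := exp (Real.pi * I * u) with hq
  have hq0 : q ≠ 0 := exp_ne_zero _
  have hqq : exp (2 * Real.pi * I * u) = q ^ 2 := by rw [hq, ← exp_nat_mul]; congr 1; push_cast; ring
  have hden : den u = q - q⁻¹ := by rw [den, exp_neg]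
  have h3 : exp (Real.pi * I * (u ^ 2 - u)) = exp (Real.pi * I * u ^ 2) / q := by
    rw [mul_sub, exp_sub]
  rw [hqq] at h2 ⊢
  rw [h3] at h1
  have hne : 1 - q ^ 2 ≠ 0 := fun h => hu (by
    rw [hden]; field_simp; linear_combination -h)
  have hne2 : q ^ 2 - 1 ≠ 0 := fun h => hne (by linear_combination -h)
  have h4 : exp (Real.pi * I * u ^ 2) / den u = -(exp (Real.pi * I * u ^ 2) / q * q ^ 2) / (1 - q ^ 2) := by
    rw [hden, div_eq_div_iff (by rwa [hden] at hu) hne]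
    field_simp
    ring
  rw [h4, ← h1, ← add_div, eq_div_iff hne]
  linear_combination h2

/-! ### Moving the line of `𝔣` into the origin -/

/-- Uniform down to t = 0. Where |Re x| > 1/2, the difference Re x - Im x = √2·t ≤ 1/4 makes the
imaginary part comparable to ‖x‖. -/
lemma two_mul_norm_le_norm_den_line (y : ℝ) {t : ℝ} (ht : 0 ≤ t) (ht1 : t ≤ 1 / 8) :
    2 * ‖(y + t * I) * dirSW‖ ≤ ‖den ((y + t * I) * dirSW)‖ := by
  set x : ℂ := (y + t * I) * dirSW with hx
  by_cases h : |x.re| ≤ 1 / 2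
  · linarith [four_mul_norm_le_norm_den h, norm_nonneg x]
  · push Not at h
    have hre := mul_dirSW_re y t
    have him := mul_dirSW_im y t
    rw [← hx] at hre him
    have h0 := half_sqrt_two_pos
    have h1 := half_sqrt_two_lt
    have hreim : |x.re| ≤ 2 * |x.im| := by
      have h2 : |x.re| - |x.im| ≤ |x.re - x.im| := abs_sub_abs_le_abs_sub x.re x.im
      have h3 : |x.re - x.im| ≤ 1 / 4 := by
        rw [hre, him, show √2 / 2 * (t - y) - -(√2 / 2 * (y + t)) = √2 / 2 * (2 * t) by ring,
          abs_of_nonneg (by positivity)]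
        nlinarith
      linarith
    have h3 : ‖x‖ ≤ 3 * |x.im| := (norm_le_abs_re_add_abs_im x).trans (by linarith)
    have h4 := two_pi_mul_abs_im_le_norm_den x
    nlinarith [Real.pi_gt_three, abs_nonneg x.im]

lemma norm_mul_dirSW_le (y : ℝ) {t : ℝ} (ht : 0 ≤ t) (ht1 : t ≤ 1 / 8) :
    ‖(y + t * I) * dirSW‖ ≤ |y| + 1 := by
  rw [norm_mul, norm_dirSW, mul_one]
  refine (norm_add_le _ _).trans ?_
  rw [norm_mul, norm_I, mul_one, norm_real, norm_real, Real.norm_eq_abs, Real.norm_eq_abs,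
    abs_of_nonneg ht]
  linarith

/-- One factor ‖x‖ of the power cancels the zero of `den` at 0; Re s < -1 leaves a positive power,
so the bound survives t = 0. -/
lemma norm_integrandSW_near_zero_le {s : ℂ} (hs : s.re < -1) (y : ℝ) {t : ℝ} (ht : 0 ≤ t)
    (ht1 : t ≤ 1 / 8) :
    ‖integrandSW s ((y + t * I) * dirSW)‖ ≤
      Real.exp ((Real.pi * ‖s‖ + Real.pi + (-s.re - 1))
        + (Real.pi * ‖s‖ + Real.pi + (-s.re - 1)) * |y| - Real.pi * y ^ 2) := by
  have hden := two_mul_norm_le_norm_den_line y ht ht1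
  have hle := norm_mul_dirSW_le y ht ht1
  have hexp := norm_exp_mul_dirSW y t
  set x : ℂ := (y + t * I) * dirSW
  have hp : 0 < -s.re - 1 := by linarith
  rcases eq_or_ne x 0 with h0 | h0
  -- Here `den 0 = 0`, and division by zero gives the value 0.
  · rw [h0, integrandSW_eq]
    simp only [den, mul_zero, neg_zero, sub_self, div_zero, norm_zero]
    exact (Real.exp_pos _).le
  have hx0 : 0 < ‖x‖ := norm_pos_iff.mpr h0
  have h1 : ‖x ^ (-s)‖ ≤ ‖x‖ ^ (-s.re) * Real.exp (Real.pi * ‖s‖) := by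
    refine (norm_cpow_le x (-s)).trans ?_
    rw [neg_re, neg_im, div_eq_mul_inv, ← Real.exp_neg]
    gcongr
    calc -(arg x * -s.im) ≤ |arg x * s.im| := by
          rw [mul_neg, neg_neg]; exact le_abs_self _
      _ ≤ _ := by
          rw [abs_mul]
          gcongr
          · exact abs_arg_le_pi x
          · exact abs_im_le_norm s
  have h2 : ‖x‖ ^ (-s.re) = ‖x‖ ^ (-s.re - 1) * ‖x‖ := by
    rw [← Real.rpow_add_one hx0.ne']; ring_nf
  have h3 : ‖x‖ ^ (-s.re - 1) ≤ Real.exp ((-s.re - 1) * |y|) := by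
    calc ‖x‖ ^ (-s.re - 1) ≤ (Real.exp |y|) ^ (-s.re - 1) := by
          gcongr
          exact hle.trans (Real.add_one_le_exp _)
      _ = _ := by rw [← Real.exp_mul, mul_comm]
  have ht2 : Real.pi * t ^ 2 ≤ Real.pi :=
    mul_le_of_le_one_right Real.pi_pos.le (by nlinarith)
  rw [integrandSW_eq, norm_div, norm_mul, hexp, div_le_iff₀ (by linarith)]
  calc ‖x ^ (-s)‖ * Real.exp (Real.pi * t ^ 2 - Real.pi * y ^ 2)
      ≤ (Real.exp ((-s.re - 1) * |y|) * ‖x‖ * Real.exp (Real.pi * ‖s‖))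
        * Real.exp (Real.pi - Real.pi * y ^ 2) := by
        refine mul_le_mul ?_ (Real.exp_le_exp.mpr (by linarith)) (Real.exp_pos _).le (by positivity)
        refine h1.trans ?_
        rw [h2]
        gcongr
    _ = Real.exp ((-s.re - 1) * |y| + Real.pi * ‖s‖ + (Real.pi - Real.pi * y ^ 2)) * ‖x‖ := by
        rw [Real.exp_add, Real.exp_add]; ring
    _ ≤ _ := by
        gcongr
        · have := mul_nonneg (show 0 ≤ Real.pi * ‖s‖ + Real.pi by
            have := Real.pi_pos; positivity) (abs_nonneg y)
          linarith
        · linarith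

lemma mul_dirSW_mem_slitPlane_of_ne {y : ℝ} (hy : y ≠ 0) :
    (y + (0 : ℝ) * I) * dirSW ∈ slitPlane := by
  rw [mem_slitPlane_iff, mul_dirSW_im]
  right
  rw [add_zero]
  exact neg_ne_zero.mpr (mul_ne_zero half_sqrt_two_pos.ne' hy)

lemma den_mul_dirSW_ne_zero_of_ne {y : ℝ} (hy : y ≠ 0) :
    den ((y + (0 : ℝ) * I) * dirSW) ≠ 0 := by
  refine den_ne_zero fun n hn => ?_
  have him := mul_dirSW_im y 0
  rw [hn, intCast_im, add_zero] at him
  exact mul_ne_zero half_sqrt_two_pos.ne' hy (by linarith)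

lemma differentiableAt_integrandSW {s x : ℂ} (hx : x ∈ slitPlane) (hd : den x ≠ 0) :
    DifferentiableAt ℂ (integrandSW s) x := by
  have h : DifferentiableAt ℂ (fun x : ℂ => x ^ (-s) * exp (Real.pi * I * x ^ 2)) x :=
    (differentiableAt_fun_id.cpow_const hx).mul (by fun_prop)
  exact h.div (differentiable_den x) hd

lemma tendsto_integrandSW_line {s : ℂ} {y : ℝ} (hy : y ≠ 0) :
    Tendsto (fun t : ℝ => integrandSW s ((y + t * I) * dirSW)) (𝓝[>] 0)
      (𝓝 (integrandSW s ((y + (0 : ℝ) * I) * dirSW))) := by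
  have h1 := (differentiableAt_integrandSW (s := s) (mul_dirSW_mem_slitPlane_of_ne hy)
    (den_mul_dirSW_ne_zero_of_ne hy)).continuousAt
  have h2 : Continuous fun t : ℝ => ((y : ℂ) + t * I) * dirSW := by fun_prop
  exact (h1.tendsto.comp (h2.tendsto 0)).mono_left nhdsWithin_le_nhds

lemma aestronglyMeasurable_integrandSW_zero_line (s : ℂ) :
    AEStronglyMeasurable (fun y : ℝ => integrandSW s ((y + (0 : ℝ) * I) * dirSW)) := by
  refine Measurable.aestronglyMeasurable ?_
  have h1 : Measurable fun y : ℝ => ((y : ℂ) + (0 : ℝ) * I) * dirSW := by fun_prop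
  have h2 : Measurable (integrandSW s) := by
    have := continuous_den.measurable
    have h3 : Measurable fun x : ℂ => x ^ (-s) := by fun_prop
    have h4 : Measurable fun x : ℂ => exp (Real.pi * I * x ^ 2) := by fun_prop
    exact (h3.mul h4).div this
  exact h2.comp h1

lemma integrable_integrandSW_zero_line {s : ℂ} (hs : s.re < -1) :
    Integrable fun y : ℝ => integrandSW s ((y + (0 : ℝ) * I) * dirSW) :=
  (integrable_gauss _).mono' (aestronglyMeasurable_integrandSW_zero_line s)
    (Eventually.of_forall fun y => norm_integrandSW_near_zero_le hs y le_rfl (by norm_num))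

lemma integral_integrandSW_line_eq {s : ℂ} {t u : ℝ} (ht : 0 < t) (htu : t ≤ u)
    (hu : u < √2 / 2) :
    ∫ y : ℝ, integrandSW s ((y + t * I) * dirSW) = ∫ y : ℝ, integrandSW s ((y + u * I) * dirSW) := by
  refine integral_horizontal_eq (G := fun w => integrandSW s (w * dirSW)) htu (fun w hw => ?_)
    (stripDecay_of_gauss fun x hx r hr => norm_integrandSW_le s ht hx hr.1
      (hr.2.trans (hu.trans half_sqrt_two_lt).le))
    (integrable_integrandSW_line s ht (htu.trans_lt hu))
    (integrable_integrandSW_line s (ht.trans_le htu) hu)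
  have h1 := mul_dirSW_mem_slitPlane w.re (ht.trans_le hw.1)
  have h2 := den_mul_dirSW_ne_zero w.re (ht.trans_le hw.1) (hw.2.trans_lt hu)
  rw [re_add_im] at h1 h2
  have h3 : DifferentiableAt ℂ (fun w : ℂ => w * dirSW) w := by fun_prop
  exact (DifferentiableAt.comp w (differentiableAt_integrandSW h1 h2) h3).differentiableWithinAt

/-- The integral is independent of the height t; let t → 0+ by dominated convergence. -/
lemma frakF_eq_zero_line {c : ℝ} (hc : c ∈ Ioo (0 : ℝ) 1) {s : ℂ} (hs : s.re < -1) :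
    frakF c s = (∫ y : ℝ, integrandSW s ((y + (0 : ℝ) * I) * dirSW)) * dirSW := by
  obtain ⟨ht, ht1⟩ := scaled_mem hc
  rw [frakF_eq]
  congr 1
  have hlim : Tendsto (fun t : ℝ => ∫ y : ℝ, integrandSW s ((y + t * I) * dirSW)) (𝓝[>] 0)
      (𝓝 (∫ y : ℝ, integrandSW s ((y + (0 : ℝ) * I) * dirSW))) := by
    have hsmall : ∀ᶠ t : ℝ in 𝓝[>] 0, t ∈ Ioc 0 (1 / 8 : ℝ) := Ioc_mem_nhdsGT (by norm_num)
    refine tendsto_integral_filter_of_dominated_convergence _ ?_ ?_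
      (integrable_gauss (Real.pi * ‖s‖ + Real.pi + (-s.re - 1))) ?_
    · filter_upwards [hsmall] with t h
      exact (continuous_integrandSW_line s h.1
        (by linarith [half_sqrt_two_gt, h.2])).aestronglyMeasurable
    · filter_upwards [hsmall] with t h
      exact Eventually.of_forall fun y => norm_integrandSW_near_zero_le hs y h.1.le h.2
    · have : ∀ᵐ y : ℝ, y ≠ 0 := by simp [ae_iff, measure_singleton]
      filter_upwards [this] with y hy
      exact tendsto_integrandSW_line hy
  refine tendsto_nhds_unique (tendsto_const_nhds.congr' ?_) hlim
  have hsmall : ∀ᶠ t : ℝ in 𝓝[>] 0, t ∈ Ioc 0 (√2 / 2 * c) := Ioc_mem_nhdsGT ht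
  filter_upwards [hsmall] with t h
  exact (integral_integrandSW_line_eq h.1 h.2 ht1).symm

/-! ### Splitting the line through the origin into two rays -/

/-- The integral of `r ^ (-s)` against the weight along the ray of argument `π / 4`. -/
def rayIntegral (s : ℂ) : ℂ :=
  ∫ r in Ioi (0 : ℝ), (r : ℂ) ^ (-s) * weightSW (exp (Real.pi * I / 4) * r)

lemma weightSW_neg (x : ℂ) : weightSW (-x) = -weightSW x := by
  rw [weightSW, weightSW, neg_sq, den_neg, div_neg]

lemma exp_mul_ofReal_cpow {θ : ℝ} (hθ : -Real.pi < θ) (hθ' : θ ≤ Real.pi) {r : ℝ} (hr : 0 < r)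
    (s : ℂ) : (exp (θ * I) * r) ^ s = exp (θ * I * s) * (r : ℂ) ^ s := by
  have hr0 : (r : ℂ) ≠ 0 := ofReal_ne_zero.mpr hr.ne'
  rw [cpow_def_of_ne_zero (mul_ne_zero (exp_ne_zero _) hr0), cpow_def_of_ne_zero hr0,
    mul_comm _ (r : ℂ), log_ofReal_mul hr (exp_ne_zero _), log_exp (by simpa using hθ)
    (by simpa using hθ'), ← exp_add, ofReal_log hr.le]
  congr 1; ring

lemma integrandSW_ray_pos (s : ℂ) {r : ℝ} (hr : 0 < r) :
    integrandSW s (((-r : ℝ) + (0 : ℝ) * I) * dirSW) =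
      exp (-(Real.pi * I * s / 4)) * ((r : ℂ) ^ (-s) * weightSW (exp (Real.pi * I / 4) * r)) := by
  have h : (((-r : ℝ) : ℂ) + (0 : ℝ) * I) * dirSW = exp (Real.pi * I / 4) * r := by
    rw [dirSW]; push_cast; ring
  have h2 := exp_mul_ofReal_cpow (θ := Real.pi / 4) (by linarith [Real.pi_pos])
    (by linarith [Real.pi_pos]) hr (-s)
  rw [show ((Real.pi / 4 : ℝ) : ℂ) * I = Real.pi * I / 4 by push_cast; ring] at h2
  rw [h, integrandSW_eq_weight, h2, mul_assoc]
  ring_nf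

/-- The lower left ray has principal argument -3π/4, which gives e^{3πis/4}; the minus sign is the
oddness of the weight. -/
lemma integrandSW_ray_neg (s : ℂ) {r : ℝ} (hr : 0 < r) :
    integrandSW s ((r + (0 : ℝ) * I) * dirSW) =
      -exp (3 * Real.pi * I * s / 4) * ((r : ℂ) ^ (-s) * weightSW (exp (Real.pi * I / 4) * r)) := by
  have h : ((r : ℂ) + (0 : ℝ) * I) * dirSW = -(exp (Real.pi * I / 4) * r) := by
    rw [dirSW]; push_cast; ring
  have h2 := exp_mul_ofReal_cpow (θ := -(3 * Real.pi / 4)) (by linarith [Real.pi_pos])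
    (by linarith [Real.pi_pos]) hr (-s)
  have h3 : exp (((-(3 * Real.pi / 4) : ℝ) : ℂ) * I) = -exp (Real.pi * I / 4) := by
    rw [show ((-(3 * Real.pi / 4) : ℝ) : ℂ) * I = Real.pi * I / 4 - Real.pi * I by push_cast; ring,
      exp_sub, exp_pi_mul_I, div_neg, div_one]
  rw [h3, neg_mul] at h2
  rw [h, integrandSW_eq_weight, weightSW_neg, h2]
  push_cast
  ring_nf

lemma integrableOn_ray {s : ℂ} (hs : s.re < -1) :
    IntegrableOn (fun r : ℝ => (r : ℂ) ^ (-s) * weightSW (exp (Real.pi * I / 4) * r)) (Ioi 0) := by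
  have h := ((integrable_integrandSW_zero_line hs).integrableOn (s := Ioi 0)).const_mul
    (-exp (3 * Real.pi * I * s / 4))⁻¹
  refine IntegrableOn.congr_fun h (fun r hr => ?_) measurableSet_Ioi
  rw [integrandSW_ray_neg s hr, inv_mul_cancel_left₀ (neg_ne_zero.mpr (exp_ne_zero _))]

/-- `𝔣` in terms of the ray integral. -/
theorem frakF_eq_rayIntegral {c : ℝ} (hc : c ∈ Ioo (0 : ℝ) 1) {s : ℂ} (hs : s.re < -1) :
    frakF c s = (exp (-(Real.pi * I * s / 4)) - exp (3 * Real.pi * I * s / 4))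
      * rayIntegral s * dirSW := by
  rw [frakF_eq_zero_line hc hs]
  congr 1
  have hi := integrable_integrandSW_zero_line hs
  rw [← intervalIntegral.integral_Iic_add_Ioi (b := 0) hi.integrableOn hi.integrableOn,
    setIntegral_congr_fun measurableSet_Ioi fun r hr => integrandSW_ray_neg s hr,
    ← neg_zero, ← integral_comp_neg_Ioi 0, neg_zero,
    setIntegral_congr_fun measurableSet_Ioi fun r hr => integrandSW_ray_pos s hr,
    integral_const_mul, integral_const_mul, rayIntegral]
  ring

/-! ### The Mellin transform of Mordell's evaluation -/

lemma exp_mul_dirSE : exp (Real.pi * I / 4) * dirSE = 1 := by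
  rw [dirSE, ← exp_add, add_neg_cancel, exp_zero]

lemma I_mul_exp_pi_div_four : I * exp (Real.pi * I / 4) = -dirSE := by
  rw [exp_pi_div_four, dirSE_eq]
  linear_combination ((√2 / 2 : ℝ) : ℂ) * I_sq

/-- The exponential kernel on the ray as a decaying exponential. -/
lemma exp_ray_eq (x : ℂ) (r : ℝ) :
    exp (2 * Real.pi * I * (exp (Real.pi * I / 4) * r) * x)
      = exp (-(2 * Real.pi * (dirSE * x) * r)) := by
  congr 1
  linear_combination (2 * Real.pi * r * x : ℂ) * I_mul_exp_pi_div_four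

lemma re_two_pi_mul (z : ℂ) : (2 * Real.pi * z).re = 2 * Real.pi * z.re := by
  rw [show (2 * Real.pi : ℂ) = ((2 * Real.pi : ℝ) : ℂ) by push_cast; ring, re_ofReal_mul]

/-- The scale `e^{π i / 4} / 2 π` of the ray transform. -/
def rayScale : ℂ := exp (Real.pi * I / 4) / (2 * Real.pi)

lemma rayScale_eq : rayScale = ((2 * Real.pi)⁻¹ : ℝ) * exp ((Real.pi / 4 : ℝ) * I) := by
  rw [rayScale, show ((Real.pi / 4 : ℝ) : ℂ) * I = Real.pi * I / 4 by push_cast; ring]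
  push_cast; ring

lemma log_rayScale : log rayScale = -(Real.log (2 * Real.pi) : ℂ) + Real.pi * I / 4 := by
  have := Real.pi_pos
  rw [rayScale_eq, log_ofReal_mul (by positivity) (exp_ne_zero _), Real.log_inv,
    log_exp (by simp; linarith) (by simp; linarith)]
  push_cast; ring

lemma rayScale_ne_zero : rayScale ≠ 0 := by
  rw [rayScale]
  exact div_ne_zero (exp_ne_zero _) (by simp [Real.pi_ne_zero])

/-- Here x = `rayScale`·z with arguments π/4 and |arg z| < π/2, so the principal logarithms add. -/
lemma cpow_sub_one_eq {x : ℂ} (hx : 0 < (dirSE * x).re) (s : ℂ) :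
    x ^ (s - 1) = rayScale ^ (s - 1) * (1 / (2 * Real.pi * (dirSE * x))) ^ (1 - s) := by
  set z : ℂ := 2 * Real.pi * (dirSE * x) with hz
  have hzre : 0 < z.re := by
    rw [hz, re_two_pi_mul]; have := Real.pi_pos; positivity
  have hz0 : z ≠ 0 := fun h => by rw [h, zero_re] at hzre; exact lt_irrefl _ hzre
  have hxz : x = rayScale * z := by
    have hpi : (Real.pi : ℂ) ≠ 0 := ofReal_ne_zero.mpr Real.pi_ne_zero
    rw [hz, rayScale]
    field_simp
    linear_combination -x * exp_mul_dirSE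
  have harg : |arg z| < Real.pi / 2 := abs_arg_lt_pi_div_two_iff.mpr (Or.inl hzre)
  obtain ⟨ha1, ha2⟩ := abs_lt.mp harg
  have hargs : arg rayScale = Real.pi / 4 := by
    rw [← log_im, log_rayScale]; simp
  have hlog : log x = log rayScale + log z := by
    rw [hxz]
    refine Complex.log_mul rayScale_ne_zero hz0 ?_
    rw [hargs]
    have := Real.pi_pos
    constructor <;> linarith
  have hx0 : x ≠ 0 := by rw [hxz]; exact mul_ne_zero rayScale_ne_zero hz0
  rw [one_div, inv_cpow _ _ (by linarith), ← cpow_neg, neg_sub, cpow_def_of_ne_zero hx0,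
    cpow_def_of_ne_zero rayScale_ne_zero, cpow_def_of_ne_zero hz0, hlog, ← exp_add]
  congr 1; ring

lemma integrableOn_cpow_mul_exp_neg_mul {a z : ℂ} (ha : 0 < a.re) (hz : 0 < z.re) :
    IntegrableOn (fun t : ℝ => (t : ℂ) ^ (a - 1) * exp (-(z * t))) (Ioi 0) := by
  have h := integrableOn_rpow_mul_exp_neg_mul_rpow (p := 1) (s := a.re - 1) (b := z.re)
    (by linarith) one_pos hz
  refine Integrable.mono' h (by fun_prop) ?_
  refine (ae_restrict_mem measurableSet_Ioi).mono fun t ht => ?_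
  rw [norm_mul, norm_cpow_eq_rpow_re_of_pos ht, norm_exp, neg_re, re_mul_ofReal, Real.rpow_one,
    sub_re, one_re, neg_mul]

/-- The Gamma integral with a complex scale of positive real part. -/
theorem integral_cpow_mul_exp_neg_complex_mul_Ioi {a z : ℂ} (ha : 0 < a.re) (hz : 0 < z.re) :
    ∫ t in Ioi (0 : ℝ), (t : ℂ) ^ (a - 1) * exp (-(z * t)) = (1 / z) ^ a * Gamma a := by
  set U : Set ℂ := {z | 0 < z.re}
  have hU : IsOpen U := isOpen_lt continuous_const continuous_re
  have hUc : IsPreconnected U := (convex_halfSpace_re_gt 0).isPreconnected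
  have hL : DifferentiableOn ℂ
      (fun z : ℂ => ∫ t in Ioi (0 : ℝ), (t : ℂ) ^ (a - 1) * exp (-(z * t))) U := by
    intro z₀ hz₀
    have hz₀' : 0 < z₀.re := hz₀
    have hbound := integrableOn_rpow_mul_exp_neg_mul_rpow (p := 1) (s := a.re) (b := z₀.re / 2)
      (by linarith) one_pos (by positivity)
    refine (hasDerivAt_integral_of_dominated_loc_of_deriv_le (𝕜 := ℂ)
      (F := fun z (t : ℝ) => (t : ℂ) ^ (a - 1) * exp (-(z * t)))
      (F' := fun z (t : ℝ) => (t : ℂ) ^ (a - 1) * (exp (-(z * t)) * -t))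
      (Metric.ball_mem_nhds z₀ (half_pos hz₀')) (Eventually.of_forall fun z => by fun_prop)
      (integrableOn_cpow_mul_exp_neg_mul ha hz₀) (by fun_prop) ?_ hbound
      ?_).2.differentiableAt.differentiableWithinAt
    · refine (ae_restrict_mem measurableSet_Ioi).mono fun t ht z hzb => ?_
      have ht0 : 0 < t := ht
      have hre : z₀.re / 2 ≤ z.re := by
        have h1 := (abs_re_le_norm (z₀ - z)).trans (mem_ball_iff_norm'.mp hzb).le
        rw [sub_re] at h1
        linarith [(abs_le.mp h1).2]
      rw [norm_mul, norm_mul, norm_cpow_eq_rpow_re_of_pos ht0, norm_exp, neg_re, re_mul_ofReal,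
        norm_neg, norm_real, Real.norm_of_nonneg ht0.le, Real.rpow_one, sub_re, one_re]
      calc t ^ (a.re - 1) * (Real.exp (-(z.re * t)) * t)
          = t ^ a.re * Real.exp (-(z.re * t)) := by
            rw [Real.rpow_sub_one ht0.ne']; field_simp
        _ ≤ _ := by
            rw [neg_mul]
            gcongr
    · refine Eventually.of_forall fun t z _ => ?_
      have h1 : HasDerivAt (fun z : ℂ => -(z * t)) (-(t : ℂ)) z := by
        simpa using ((hasDerivAt_id z).mul_const (t : ℂ)).fun_neg
      exact h1.cexp.const_mul _
  have hR : DifferentiableOn ℂ (fun z : ℂ => (1 / z) ^ a * Gamma a) U := by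
    intro w hw
    have hw' : 0 < w.re := hw
    have hw0 : w ≠ 0 := fun h => by rw [h, zero_re] at hw'; exact lt_irrefl _ hw'
    have h1 : DifferentiableAt ℂ (fun z : ℂ => 1 / z) w :=
      (differentiableAt_const _).div differentiableAt_fun_id hw0
    have h2 : 1 / w ∈ slitPlane := by
      left
      rw [one_div, inv_re]
      exact div_pos hw' (normSq_pos.mpr hw0)
    exact ((h1.cpow_const h2).mul_const _).differentiableWithinAt
  -- Both sides are holomorphic in z on the right half-plane and agree at real z > 0, which
  -- accumulate at 1.
  refine (hL.analyticOnNhd hU).eqOn_of_preconnected_of_frequently_eq (hR.analyticOnNhd hU) hUc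
    (z₀ := 1) (by simp [U]) ?_ hz
  have ht : Tendsto (fun x : ℝ => (x : ℂ)) (𝓝[≠] 1) (𝓝[≠] 1) := by
    refine tendsto_nhdsWithin_iff.mpr ⟨?_, ?_⟩
    · simpa using (continuous_ofReal.tendsto (1 : ℝ)).mono_left nhdsWithin_le_nhds
    · filter_upwards [self_mem_nhdsWithin] with x hx
      simpa using hx
  refine ht.frequently (Eventually.frequently ?_)
  filter_upwards [mem_nhdsWithin_of_mem_nhds (Ioi_mem_nhds one_pos)] with x hx
  exact integral_cpow_mul_exp_neg_mul_Ioi ha hx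

/-- The Gamma integral along the ray of argument `π / 4`. -/
lemma Gamma_mul_cpow_eq {s x : ℂ} (hs : s.re < 1) (hx : 0 < (dirSE * x).re) :
    Gamma (1 - s) * x ^ (s - 1) = rayScale ^ (s - 1) *
      ∫ r in Ioi (0 : ℝ), (r : ℂ) ^ (-s) *
        exp (2 * Real.pi * I * (exp (Real.pi * I / 4) * r) * x) := by
  simp_rw [exp_ray_eq]
  have h := integral_cpow_mul_exp_neg_complex_mul_Ioi (a := 1 - s) (z := 2 * Real.pi * (dirSE * x))
    (by simpa using hs) (by rw [re_two_pi_mul]; have := Real.pi_pos; positivity)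
  rw [show (1 : ℂ) - s - 1 = -s by ring] at h
  rw [h, cpow_sub_one_eq hx s]
  ring

lemma integrableOn_cpow_mul_exp_ray {s x : ℂ} (hs : s.re < 1) (hx : 0 < (dirSE * x).re) :
    IntegrableOn (fun r : ℝ => (r : ℂ) ^ (-s) *
      exp (2 * Real.pi * I * (exp (Real.pi * I / 4) * r) * x)) (Ioi 0) := by
  -- Otherwise the integral would be 0 by convention, but Γ(1-s)x^{s-1} is nonzero.
  by_contra hc
  have h := Gamma_mul_cpow_eq hs hx
  rw [integral_undef hc, mul_zero] at h
  refine mul_ne_zero (Gamma_ne_zero_of_re_pos (by simpa using hs)) ?_ h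
  rw [Ne, cpow_eq_zero_iff, not_and_or]
  left
  rintro rfl
  simp at hx

lemma norm_cpow_mul_exp_ray (s : ℂ) {r : ℝ} (hr : 0 < r) (x : ℂ) :
    ‖(r : ℂ) ^ (-s) * exp (2 * Real.pi * I * (exp (Real.pi * I / 4) * r) * x)‖
      = r ^ (-s.re) * Real.exp (-(2 * Real.pi * (dirSE * x).re * r)) := by
  rw [exp_ray_eq, norm_mul, norm_cpow_eq_rpow_re_of_pos hr, norm_exp, neg_re, neg_re,
    re_mul_ofReal, re_two_pi_mul]

lemma re_dirSE_mul_ofReal (x : ℝ) : (dirSE * x).re = √2 / 2 * x := by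
  rw [re_mul_ofReal]; simp [dirSE_eq]

lemma re_dirSE_mul_line (d y : ℝ) : (dirSE * (d + y * dirSE)).re = √2 / 2 * d := by
  rw [show dirSE * (d + y * dirSE) = dirSE * d + y * dirSE ^ 2 by ring, dirSE_sq, add_re,
    re_dirSE_mul_ofReal, re_ofReal_mul]
  simp

lemma norm_exp_ray_lt_one {r : ℝ} (hr : 0 < r) :
    ‖exp (2 * Real.pi * I * (exp (Real.pi * I / 4) * r))‖ < 1 := by
  have h := exp_ray_eq 1 r
  rw [mul_one] at h
  rw [h, norm_exp, Real.exp_lt_one_iff, neg_re, re_mul_ofReal, re_two_pi_mul, mul_one]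
  have h2 := re_dirSE_mul_ofReal 1
  rw [ofReal_one, mul_one, mul_one] at h2
  rw [h2]
  have := half_sqrt_two_pos
  have := Real.pi_pos
  simp only [Left.neg_neg_iff]
  positivity

lemma den_ray_ne_zero {r : ℝ} (hr : 0 < r) : den (exp (Real.pi * I / 4) * r) ≠ 0 := by
  refine den_ne_zero fun n hn => ?_
  have := congrArg Complex.im hn
  rw [exp_pi_div_four] at this
  simp at this
  exact hr.ne' this

/-- The Mellin transform of the geometric term produces the zeta function. -/
lemma integral_geometric_ray {s : ℂ} (hs : s.re < 0) :
    rayScale ^ (s - 1) * ∫ r in Ioi (0 : ℝ), (r : ℂ) ^ (-s) *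
      (exp (2 * Real.pi * I * (exp (Real.pi * I / 4) * r)) /
        (1 - exp (2 * Real.pi * I * (exp (Real.pi * I / 4) * r))))
      = Gamma (1 - s) * riemannZeta (1 - s) := by
  set F : ℕ → ℝ → ℂ := fun n r => (r : ℂ) ^ (-s) *
    exp (2 * Real.pi * I * (exp (Real.pi * I / 4) * r) * ((n + 1 : ℝ) : ℂ)) with hF
  have hre : ∀ n : ℕ, 0 < (dirSE * ((n + 1 : ℝ) : ℂ)).re := fun n => by
    rw [re_dirSE_mul_ofReal]; have := half_sqrt_two_pos; positivity
  have hint : ∀ n, Integrable (F n) (volume.restrict (Ioi 0)) := fun n =>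
    integrableOn_cpow_mul_exp_ray (by linarith) (hre n)
  have hnorm : ∀ n : ℕ, ∫ r in Ioi (0 : ℝ), ‖F n r‖
      = (1 / (n + 1 : ℝ)) ^ (1 - s.re) *
        ((1 / (2 * Real.pi * (√2 / 2))) ^ (1 - s.re) * Real.Gamma (1 - s.re)) := by
    intro n
    have h := Real.integral_rpow_mul_exp_neg_mul_Ioi (a := 1 - s.re)
      (r := 2 * Real.pi * (√2 / 2 * (n + 1))) (by linarith)
      (by have := Real.pi_pos; positivity)
    rw [setIntegral_congr_fun measurableSet_Ioi fun r hr => norm_cpow_mul_exp_ray s hr _,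
      re_dirSE_mul_ofReal]
    rw [show 1 - s.re - 1 = -s.re by ring] at h
    rw [h, ← mul_assoc (_ ^ _) (_ ^ _), ← Real.mul_rpow (by positivity) (by have := Real.pi_pos; positivity)]
    congr 2
    field_simp
  -- The norms are a constant times (n+1)^{-(1 - Re s)}, summable because Re s < 0; this licenses
  -- exchanging sum and integral.
  have hsum : Summable fun n : ℕ => ∫ r in Ioi (0 : ℝ), ‖F n r‖ := by
    simp_rw [hnorm]
    refine Summable.mul_right _ ?_
    have h := (summable_nat_add_iff 1).mpr
      (Real.summable_one_div_nat_rpow.mpr (show 1 < 1 - s.re by linarith))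
    refine h.congr fun n => ?_
    rw [Real.div_rpow zero_le_one (by positivity), Real.one_rpow]
    push_cast; rfl
  have h1 := hasSum_integral_of_summable_integral_norm hint hsum
  have h2 : ∀ r ∈ Ioi (0 : ℝ), ∑' n, F n r = (r : ℂ) ^ (-s) *
      (exp (2 * Real.pi * I * (exp (Real.pi * I / 4) * r)) /
        (1 - exp (2 * Real.pi * I * (exp (Real.pi * I / 4) * r)))) := by
    intro r hr
    have hq := norm_exp_ray_lt_one hr
    rw [tsum_mul_left]
    congr 1
    set q := exp (2 * Real.pi * I * (exp (Real.pi * I / 4) * r)) with hqdef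
    rw [div_eq_mul_inv q, ← tsum_geometric_of_norm_lt_one hq, ← tsum_mul_left]
    refine tsum_congr fun n => ?_
    rw [← pow_succ', hqdef, ← exp_nat_mul]
    congr 1; push_cast; ring
  rw [setIntegral_congr_fun measurableSet_Ioi h2] at h1
  rw [← h1.tsum_eq, ← tsum_mul_left, zeta_eq_tsum_one_div_nat_add_one_cpow (by rw [sub_re, one_re]; linarith),
    ← tsum_mul_left]
  refine tsum_congr fun n => ?_
  rw [hF]
  simp only
  rw [← Gamma_mul_cpow_eq (by linarith) (hre n), one_div, ← cpow_neg, neg_sub]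
  push_cast; rfl

lemma mordellIntegrand_zero (u x : ℂ) :
    mordellIntegrand u x = exp (2 * Real.pi * I * u * x) * mordellIntegrand 0 x := by
  rw [mordellIntegrand, mordellIntegrand, exp_add]
  simp
  ring

lemma Gamma_mul_integrandSE {d : ℝ} (hd : 0 < d) {s : ℂ} (hs : s.re < 1) (y : ℝ) :
    Gamma (1 - s) * integrandSE s (d + y * dirSE) = rayScale ^ (s - 1) *
      ∫ r in Ioi (0 : ℝ), (r : ℂ) ^ (-s) *
        mordellIntegrand (exp (Real.pi * I / 4) * r) (d + y * dirSE) := by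
  have hx : 0 < (dirSE * (d + y * dirSE)).re := by
    rw [re_dirSE_mul_line]; exact mul_pos half_sqrt_two_pos hd
  have h0 : integrandSE s (d + y * dirSE)
      = (d + y * dirSE) ^ (s - 1) * mordellIntegrand 0 (d + y * dirSE) := by
    rw [integrandSE_eq, mordellIntegrand, mul_div_assoc]; simp
  simp_rw [fun r : ℝ => mordellIntegrand_zero (exp (Real.pi * I / 4) * r) (d + y * dirSE),
    ← mul_assoc (_ ^ (-s))]
  rw [integral_mul_const, h0, ← mul_assoc, Gamma_mul_cpow_eq hs hx, mul_assoc]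

/-- With u = e^{πi/4}r and x = d + y·`dirSE` one has ux = ud + ry. The coupling factor e^{2πiry} has
modulus 1, so the integrand is a bounded factor times a product of integrable functions, and Fubini
applies. -/
lemma integrable_prod_mordell {d : ℝ} (hd : d ∈ Ioo (0 : ℝ) 1) {s : ℂ} (hs : s.re < 1) :
    Integrable (fun p : ℝ × ℝ => (p.2 : ℂ) ^ (-s) *
      mordellIntegrand (exp (Real.pi * I / 4) * p.2) (d + p.1 * dirSE))
      (volume.prod (volume.restrict (Ioi 0))) := by
  have h1 := integrable_mordellIntegrand hd 0
  have h2 : Integrable (fun r : ℝ => (r : ℂ) ^ (-s) *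
      exp (2 * Real.pi * I * (exp (Real.pi * I / 4) * r) * d)) (volume.restrict (Ioi 0)) :=
    integrableOn_cpow_mul_exp_ray hs
      (by rw [re_dirSE_mul_ofReal]; exact mul_pos half_sqrt_two_pos hd.1)
  have h3 := (h1.mul_prod h2).bdd_mul (c := 1)
    (f := fun p : ℝ × ℝ => exp (((2 * Real.pi * p.2 * p.1 : ℝ) : ℂ) * I))
    (by fun_prop) (Eventually.of_forall fun p => by rw [norm_exp_ofReal_mul_I])
  refine h3.congr (Eventually.of_forall fun p => ?_)
  simp only
  rw [mordellIntegrand_zero (exp (Real.pi * I / 4) * p.2)]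
  have h4 : exp (2 * Real.pi * I * (exp (Real.pi * I / 4) * p.2) * (d + p.1 * dirSE))
      = exp (2 * Real.pi * I * (exp (Real.pi * I / 4) * p.2) * d)
        * exp (((2 * Real.pi * p.2 * p.1 : ℝ) : ℂ) * I) := by
    rw [← exp_add]
    congr 1
    push_cast
    linear_combination (2 * Real.pi * I * p.2 * p.1 : ℂ) * exp_mul_dirSE
  rw [h4]
  ring

/-- `𝔤` in terms of the zeta function and the ray integral. -/
theorem Gamma_mul_frakG_eq {d : ℝ} (hd : d ∈ Ioo (0 : ℝ) 1) {s : ℂ} (hs : s.re < -1) :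
    Gamma (1 - s) * frakG d s =
      Gamma (1 - s) * riemannZeta (1 - s) + rayScale ^ (s - 1) * rayIntegral s := by
  have hprod := integrable_prod_mordell hd (s := s) (by linarith)
  have h1 : Gamma (1 - s) * frakG d s = rayScale ^ (s - 1) *
      ∫ r in Ioi (0 : ℝ), (r : ℂ) ^ (-s) * (mordell d (exp (Real.pi * I / 4) * r) * dirSE) := by
    calc Gamma (1 - s) * frakG d s
        = (∫ y : ℝ, Gamma (1 - s) * integrandSE s (d + y * dirSE)) * dirSE := by
          rw [frakG, lineIntegral, integral_mul_const, integral_const_mul, mul_assoc]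
      _ = rayScale ^ (s - 1) * (∫ y : ℝ, ∫ r in Ioi (0 : ℝ), (r : ℂ) ^ (-s) *
            mordellIntegrand (exp (Real.pi * I / 4) * r) (d + y * dirSE)) * dirSE := by
          simp_rw [Gamma_mul_integrandSE hd.1 (show s.re < 1 by linarith)]
          rw [integral_const_mul]
      _ = _ := by
          rw [integral_integral_swap hprod, mul_assoc, ← integral_mul_const]
          congr 2; ext r
          rw [integral_const_mul, mordell, mul_assoc]
  have hint : Integrable (fun r : ℝ => (r : ℂ) ^ (-s) *
      (mordell d (exp (Real.pi * I / 4) * r) * dirSE)) (volume.restrict (Ioi 0)) := by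
    have h := hprod.integral_prod_right.mul_const dirSE
    refine h.congr (Eventually.of_forall fun r => ?_)
    simp only
    rw [integral_const_mul, mordell, mul_assoc]
  have h2 : ∀ r ∈ Ioi (0 : ℝ), (r : ℂ) ^ (-s) *
      (exp (2 * Real.pi * I * (exp (Real.pi * I / 4) * r)) /
        (1 - exp (2 * Real.pi * I * (exp (Real.pi * I / 4) * r))))
      = (r : ℂ) ^ (-s) * (mordell d (exp (Real.pi * I / 4) * r) * dirSE)
        - (r : ℂ) ^ (-s) * weightSW (exp (Real.pi * I / 4) * r) := by
    intro r hr
    rw [mordell_mul_dirSE hd (den_ray_ne_zero hr), weightSW]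
    ring
  rw [h1, ← integral_geometric_ray (s := s) (by linarith),
    setIntegral_congr_fun measurableSet_Ioi h2, integral_sub hint (integrableOn_ray hs),
    rayIntegral]
  ring

/-! ### The integral representation -/

/-- Eliminates `rayIntegral`; the difference of the phases of the two rays is what becomes 2
sin(πs/2). -/
lemma two_sin_mul_eq {c d : ℝ} (hc : c ∈ Ioo (0 : ℝ) 1) (hd : d ∈ Ioo (0 : ℝ) 1) {s : ℂ}
    (hs : s.re < -1) :
    2 * sin (Real.pi * s / 2) * Gamma (1 - s) * (riemannZeta (1 - s) - frakG d s)
      = (2 * Real.pi : ℂ) ^ (1 - s) * frakF c s := by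
  have h1 := Gamma_mul_frakG_eq hd hs
  have h2 : rayScale ^ (s - 1)
      = (2 * Real.pi : ℂ) ^ (1 - s) * exp (Real.pi * I * (s - 1) / 4) := by
    have hp : (2 * Real.pi : ℂ) ≠ 0 := by simp [Real.pi_ne_zero]
    rw [cpow_def_of_ne_zero rayScale_ne_zero, cpow_def_of_ne_zero hp, log_rayScale, ← exp_add,
      ofReal_log (by have := Real.pi_pos; positivity)]
    congr 1; push_cast; ring
  have h3 : 2 * sin (Real.pi * s / 2) * exp (Real.pi * I * (s - 1) / 4)
      = exp (Real.pi * I / 4) *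
        (exp (-(Real.pi * I * s / 4)) - exp (3 * Real.pi * I * s / 4)) := by
    have hexpI : exp (Real.pi * I * (s - 1) / 4) * I = exp (Real.pi * I * (s - 1) / 4 + Real.pi / 2 * I) := by
      rw [exp_add, exp_pi_div_two_mul_I]
    have e1 : exp (3 * Real.pi * I * s / 4) * exp (Real.pi * I / 4)
        = exp (Real.pi * s / 2 * I) * exp (Real.pi * I * (s - 1) / 4) * I := by
      rw [mul_assoc (exp _) (exp _), hexpI, ← exp_add, ← exp_add]
      congr 1; ring
    have e2 : exp (-(Real.pi * I * s / 4)) * exp (Real.pi * I / 4)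
        = exp (-(Real.pi * s / 2) * I) * exp (Real.pi * I * (s - 1) / 4) * I := by
      rw [mul_assoc (exp _) (exp _), hexpI, ← exp_add, ← exp_add]
      congr 1; ring
    rw [Complex.sin]
    linear_combination e1 - e2
  rw [frakF_eq_rayIntegral hc hs, dirSW]
  rw [h2] at h1
  linear_combination (-2 * sin (Real.pi * s / 2)) * h1
    - (2 * Real.pi : ℂ) ^ (1 - s) * rayIntegral s * h3

/-- Reflection and duplication, packaged in `Gammaℝ_div_Gammaℝ_one_sub`, symmetrize the factor.
Reciprocals are used because 1/`Gammaℝ` is entire. -/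
lemma Gammaℝ_inv_mul_eq_of_re_lt {c d : ℝ} (hc : c ∈ Ioo (0 : ℝ) 1) (hd : d ∈ Ioo (0 : ℝ) 1)
    {s : ℂ} (hs : s.re < -1) :
    (Gammaℝ s)⁻¹ * (riemannZeta (1 - s) - frakG d s) = (Gammaℝ (1 - s))⁻¹ * frakF c s := by
  have h1 := two_sin_mul_eq hc hd hs
  have h2 := Gammaℝ_div_Gammaℝ_one_sub (s := 1 - s) fun n h => by
    have := congrArg Complex.re h
    simp at this
    have hn : (0 : ℝ) ≤ n := n.cast_nonneg
    linarith
  have hg : Gammaℝ (1 - s) ≠ 0 := Gammaℝ_ne_zero_of_re_pos (by simp; linarith)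
  rw [sub_sub_cancel, Gammaℂ_def, show (Real.pi : ℂ) * (1 - s) / 2 = Real.pi / 2 - Real.pi * s / 2 by
    ring, cos_pi_div_two_sub, div_eq_mul_inv] at h2
  have hp : (2 * Real.pi : ℂ) ≠ 0 := by simp [Real.pi_ne_zero]
  rw [cpow_neg] at h2
  have hq : (2 * Real.pi : ℂ) ^ (1 - s) ≠ 0 := by rw [Ne, cpow_eq_zero_iff]; tauto
  have h3 : frakF c s = ((2 * Real.pi : ℂ) ^ (1 - s))⁻¹ *
      (2 * sin (Real.pi * s / 2) * Gamma (1 - s) * (riemannZeta (1 - s) - frakG d s)) := by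
    rw [h1, inv_mul_cancel_left₀ hq]
  rw [eq_inv_mul_iff_mul_eq₀ hg, ← mul_assoc, h2, h3]
  ring

/-- Both sides are holomorphic on the connected set s ≠ 0, where ζ(1-s) has no pole, and agree on a
half-plane. -/
lemma Gammaℝ_inv_mul_eq {c d : ℝ} (hc : c ∈ Ioo (0 : ℝ) 1) (hd : d ∈ Ioo (0 : ℝ) 1)
    {s : ℂ} (hs : s ≠ 0) :
    (Gammaℝ s)⁻¹ * (riemannZeta (1 - s) - frakG d s) = (Gammaℝ (1 - s))⁻¹ * frakF c s := by
  have hL : DifferentiableOn ℂ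
      (fun s => (Gammaℝ s)⁻¹ * (riemannZeta (1 - s) - frakG d s)) {0}ᶜ := by
    intro z hz
    have h1 : DifferentiableAt ℂ (fun s => riemannZeta (1 - s)) z :=
      DifferentiableAt.comp z (differentiableAt_riemannZeta (by simpa using hz)) (by fun_prop)
    exact ((differentiable_Gammaℝ_inv z).mul
      (h1.sub (differentiable_frakG hd z))).differentiableWithinAt
  have hR : DifferentiableOn ℂ (fun s => (Gammaℝ (1 - s))⁻¹ * frakF c s) {0}ᶜ := by
    have h1 : Differentiable ℂ fun s => (Gammaℝ (1 - s))⁻¹ :=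
      differentiable_Gammaℝ_inv.comp (by fun_prop)
    exact (h1.mul (differentiable_frakF hc)).differentiableOn
  have hopen : IsOpen ({0}ᶜ : Set ℂ) := isOpen_compl_singleton
  refine (hL.analyticOnNhd hopen).eqOn_of_preconnected_of_eventuallyEq (hR.analyticOnNhd hopen)
    (isConnected_compl_singleton_of_one_lt_rank (by simp) 0).isPreconnected (z₀ := -2)
    (by simp) ?_ hs
  have : {z : ℂ | z.re < -1} ∈ 𝓝 (-2 : ℂ) :=
    (isOpen_lt continuous_re continuous_const).mem_nhds (by norm_num)
  filter_upwards [this] with z hz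
  exact Gammaℝ_inv_mul_eq_of_re_lt hc hd hz

theorem integral_representation {c d : ℝ} (hc : c ∈ Ioo (0 : ℝ) 1) (hd : d ∈ Ioo (0 : ℝ) 1)
    {s : ℂ} (h0 : ∀ n : ℕ, s ≠ -(2 * (n : ℂ))) (h1 : ∀ n : ℕ, s ≠ 2 * (n : ℂ) + 1) :
    Gammaℝ (1 - s) * riemannZeta (1 - s)
      = Gammaℝ s * frakF c s + Gammaℝ (1 - s) * frakG d s := by
  have hs0 : s ≠ 0 := by simpa using h0 0
  -- `Gammaℝ` takes the default value 0 at its poles and vanishes nowhere else.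
  have hA : Gammaℝ s ≠ 0 := fun h => by
    obtain ⟨n, hn⟩ := Gammaℝ_eq_zero_iff.mp h
    exact h0 n hn
  have hB : Gammaℝ (1 - s) ≠ 0 := fun h => by
    obtain ⟨n, hn⟩ := Gammaℝ_eq_zero_iff.mp h
    exact h1 n (by linear_combination -hn)
  have h := Gammaℝ_inv_mul_eq hc hd hs0
  field_simp at h
  linear_combination h

/-! ### Functional equation and the critical line -/

/-- Read off from the symmetry of `completedRiemannZeta`, independently of the integral
representation. -/
theorem functional_equation {s : ℂ} (h0 : ∀ n : ℕ, s ≠ -(2 * (n : ℂ)))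
    (h1 : ∀ n : ℕ, s ≠ 2 * (n : ℂ) + 1) :
    Gammaℝ s * riemannZeta s = Gammaℝ (1 - s) * riemannZeta (1 - s) := by
  have hs0 : s ≠ 0 := by simpa using h0 0
  have hs1 : 1 - s ≠ 0 := fun h => h1 0 (by push_cast; linear_combination -h)
  have hA : Gammaℝ s ≠ 0 := fun h => by
    obtain ⟨n, hn⟩ := Gammaℝ_eq_zero_iff.mp h
    exact h0 n hn
  have hB : Gammaℝ (1 - s) ≠ 0 := fun h => by
    obtain ⟨n, hn⟩ := Gammaℝ_eq_zero_iff.mp h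
    exact h1 n (by linear_combination -hn)
  rw [riemannZeta_def_of_ne_zero hs0, riemannZeta_def_of_ne_zero hs1, mul_div_cancel₀ _ hA,
    mul_div_cancel₀ _ hB, completedRiemannZeta_one_sub]

lemma Gammaℝ_conj (s : ℂ) : Gammaℝ (starRingEnd ℂ s) = starRingEnd ℂ (Gammaℝ s) := by
  have hpi : arg (Real.pi : ℂ) ≠ Real.pi := by
    rw [arg_ofReal_of_nonneg Real.pi_pos.le]; exact Real.pi_ne_zero.symm
  have h := cpow_conj (Real.pi : ℂ) (-s / 2) hpi
  rw [conj_ofReal] at h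
  have h2 : starRingEnd ℂ (s / 2) = starRingEnd ℂ s / 2 := by rw [map_div₀, map_ofNat]
  rw [Gammaℝ_def, Gammaℝ_def, map_mul, ← h, ← Gamma_conj, h2, neg_div, neg_div, map_neg, h2]

theorem completed_zeta_eq_re_phi {c : ℝ} (hc : c ∈ Ioo (0 : ℝ) 1) {s : ℂ} (hs : s.re = 1 / 2) :
    Gammaℝ s * riemannZeta s = ((phi c s).re : ℂ) := by
  have h0 : ∀ n : ℕ, s ≠ -(2 * (n : ℂ)) := fun n h => by
    rw [h] at hs
    simp at hs
    have hn : (0 : ℝ) ≤ n := n.cast_nonneg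
    linarith
  have h1 : ∀ n : ℕ, s ≠ 2 * (n : ℂ) + 1 := fun n h => by
    rw [h] at hs
    simp at hs
    have hn : (0 : ℝ) ≤ n := n.cast_nonneg
    linarith
  have hconj : 1 - starRingEnd ℂ s = s := by
    apply Complex.ext
    · simp [hs]; norm_num
    · simp
  have hconj' : 1 - s = starRingEnd ℂ s := by linear_combination hconj
  have hphi : phi c s = 2 * (Gammaℝ s * frakF c s) := by
    rw [phi, Gammaℝ_def]; ring
  rw [functional_equation h0 h1, integral_representation hc hc h0 h1, frakG_eq_conj hc.1, hconj,
    hconj', Gammaℝ_conj, ← map_mul, add_conj, hphi]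
  simp

end RiemannIntegral

end

theorem mainTheorem4 (c d : ℝ) (hc : c ∈ Set.Ioo (0 : ℝ) 1) (hd : d ∈ Set.Ioo (0 : ℝ) 1) :
    -- both integrals converge absolutely for every `s` and are entire functions of `s`
    (∀ s : ℂ,
      RiemannIntegral.LineIntegrable (RiemannIntegral.integrandSW s) c RiemannIntegral.dirSW ∧
      RiemannIntegral.LineIntegrable (RiemannIntegral.integrandSE s) d RiemannIntegral.dirSE) ∧
    Differentiable ℂ (RiemannIntegral.frakF c) ∧
    Differentiable ℂ (RiemannIntegral.frakG d) ∧
    -- the integral representation and the functional equation, at every `s` that is not a pole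
    -- of `Γ(s/2)` or of `Γ((1-s)/2)`
    (∀ s : ℂ, (∀ n : ℕ, s ≠ -(2 * (n : ℂ))) → (∀ n : ℕ, s ≠ 2 * (n : ℂ) + 1) →
      (Real.pi : ℂ) ^ (-(1 - s) / 2) * Complex.Gamma ((1 - s) / 2) * riemannZeta (1 - s) =
          (Real.pi : ℂ) ^ (-s / 2) * Complex.Gamma (s / 2) * RiemannIntegral.frakF c s +
          (Real.pi : ℂ) ^ (-(1 - s) / 2) * Complex.Gamma ((1 - s) / 2) *
            RiemannIntegral.frakG d s ∧
      (Real.pi : ℂ) ^ (-s / 2) * Complex.Gamma (s / 2) * riemannZeta s =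
          (Real.pi : ℂ) ^ (-(1 - s) / 2) * Complex.Gamma ((1 - s) / 2) * riemannZeta (1 - s)) ∧
    -- on the critical line the completed zeta function is the real part of `φ`
    (∀ s : ℂ, s.re = 1 / 2 →
      (Real.pi : ℂ) ^ (-s / 2) * Complex.Gamma (s / 2) * riemannZeta s =
        ((RiemannIntegral.phi c s).re : ℂ)) := by
  refine ⟨fun s => ⟨RiemannIntegral.lineIntegrable_integrandSW hc s,
    RiemannIntegral.lineIntegrable_integrandSE hd s⟩, RiemannIntegral.differentiable_frakF hc,
    RiemannIntegral.differentiable_frakG hd, fun s h0 h1 => ⟨?_, ?_⟩, fun s hs => ?_⟩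
  -- `Gammaℝ s` unfolds to π^{-s/2}Γ(s/2).
  · exact RiemannIntegral.integral_representation hc hd h0 h1
  · exact RiemannIntegral.functional_equation h0 h1
  · exact RiemannIntegral.completed_zeta_eq_re_phi hc hs
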